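/- For $\kappa\in\mathbb{R}$ let $M_\kappa^2$ be the complete, simply connected Riemannian surface of constant curvature $\kappa$ (the round sphere of radius $1/\sqrt{\kappa}$ if $\kappa>0$, the Euclidean plane if $\kappa=0$, the hyperbolic plane with its metric multiplied by $1/\sqrt{-\kappa}$ if $\kappa<0$), let $d_\kappa$ be its distance function, and let $D_\kappa=\pi/\sqrt{\kappa}$ if $\kappa>0$ and $D_\kappa=\infty$ if $\kappa\le 0$. For points $a,b\in M_\kappa^2$ with $d_\kappa(a,b)<D_\kappa$ let $[a,b]$ be the unique geodesic segment with endpoints $a$ and $b$. A metric space $(X,d_X)$, not assumed geodesic, is called a $\mathrm{Cycl}_4(\kappa)$ space if for every map $f:\mathbb{Z}/4\mathbb{Z}\to X$ with $\sum_{i} d_X(f(i),f(i+1))<2D_\kappa$ there is a map $g:\mathbb{Z}/4\mathbb{Z}\to M_\kappa^2$ such that $d_\kappa(g(i),g(i+1))\le d_X(f(i),f(i+1))$ for all $i$, and $d_\kappa(g(i),g(j))\ge d_X(f(i),f(j))$ for all $i,j$ with $j\ne i+1$ and $i\ne j+1$. **Theorem.** Let $\kappa\in\mathbb{R}$ and let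 $X$ be a $\mathrm{Cycl}_4(\kappa)$ space. Let $n\ge 3$ be an integer and let $f:\mathbb{Z}/n\mathbb{Z}\to X$ be a map with $$\sum_{i\in\mathbb{Z}/n\mathbb{Z}} d_X(f(i),f(i+1))<2D_\kappa \quad\text{and}\quad f(j)\ne f(j+1)\ \text{ for every } j\in\mathbb{Z}/n\mathbb{Z}.$$ Then there is a map $g:\mathbb{Z}/n\mathbb{Z}\to M_\kappa^2$ such that 1. $d_\kappa(g(i),g(i+1))=d_X(f(i),f(i+1))$ and $d_\kappa(g(i),g(j))\ge d_X(f(i),f(j))$ for all $i,j\in\mathbb{Z}/n\mathbb{Z}$; 2. $[g(i),g(j)]\cap[g(i-1),g(i+1)]\ne\emptyset$ for all $i,j\in\mathbb{Z}/n\mathbb{Z}$ with $i\ne j$. (By 1 and the bound on the perimeter, any two of the points $g(i)$ are at distance less than $D_\kappa$, so the segments in 2 are well defined.) -/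

import Mathlib

/-! ### The model plane of constant curvature `κ` -/

/-- The bilinear form `x₀ y₀ + sign(κ) (x₁ y₁ + x₂ y₂)` on `ℝ³`: the Euclidean inner product for
`κ > 0`, and minus the Lorentzian inner product `-x₀ y₀ + x₁ y₁ + x₂ y₂` for `κ < 0`. -/
noncomputable def modelForm (κ : ℝ) (x y : Fin 3 → ℝ) : ℝ :=
  x 0 * y 0 + Real.sign κ * (x 1 * y 1 + x 2 * y 2)

/-- The points of the model plane `M_κ²`: the unit sphere in `ℝ³` if `κ > 0`, the affine plane
`x₀ = 1` in `ℝ³` if `κ = 0`, and the upper sheet `-x₀² + x₁² + x₂² = -1`, `x₀ > 0` of the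
hyperboloid if `κ < 0`. -/
@[ext]
structure ModelPlane (κ : ℝ) where
  /-- the coordinates of the point in `ℝ³` -/
  coord : Fin 3 → ℝ
  form_self : modelForm κ coord coord = 1
  pos : κ ≤ 0 → 0 < coord 0

/-- The distance `d_κ`: the angular metric of the unit sphere divided by `√κ` if `κ > 0`, the
Euclidean metric if `κ = 0`, and the hyperbolic metric of the hyperboloid divided by `√(-κ)` if
`κ < 0`. -/
noncomputable def modelDist (κ : ℝ) (p q : ModelPlane κ) : ℝ :=
  if 0 < κ then Real.arccos (modelForm κ p.coord q.coord) / √κ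
  else if κ = 0 then √((p.coord 1 - q.coord 1) ^ 2 + (p.coord 2 - q.coord 2) ^ 2)
  else Real.arcosh (modelForm κ p.coord q.coord) / √(-κ)

theorem modelForm_comm (κ : ℝ) (x y : Fin 3 → ℝ) : modelForm κ x y = modelForm κ y x := by
  unfold modelForm; ring

theorem modelForm_gram (κ : ℝ) (p q r : ModelPlane κ) :
    (modelForm κ p.coord r.coord - modelForm κ p.coord q.coord * modelForm κ q.coord r.coord) ^ 2 ≤
      (modelForm κ p.coord q.coord ^ 2 - 1) * (modelForm κ q.coord r.coord ^ 2 - 1) := by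
  have hp := p.form_self
  have hq := q.form_self
  have hr := r.form_self
  generalize p.coord = x at hp ⊢
  generalize q.coord = y at hq ⊢
  generalize r.coord = z at hr ⊢
  have key : modelForm κ x x * modelForm κ y y * modelForm κ z z
      + 2 * modelForm κ x y * modelForm κ y z * modelForm κ x z
      - modelForm κ x x * modelForm κ y z ^ 2 - modelForm κ y y * modelForm κ x z ^ 2
      - modelForm κ z z * modelForm κ x y ^ 2
      = (Real.sign κ * (x 0 * (y 1 * z 2 - y 2 * z 1) - x 1 * (y 0 * z 2 - y 2 * z 0)
          + x 2 * (y 0 * z 1 - y 1 * z 0))) ^ 2 := by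
    unfold modelForm; ring
  rw [hp, hq, hr] at key
  nlinarith [sq_nonneg (Real.sign κ * (x 0 * (y 1 * z 2 - y 2 * z 1)
    - x 1 * (y 0 * z 2 - y 2 * z 0) + x 2 * (y 0 * z 1 - y 1 * z 0)))]

theorem ModelPlane.ext_coord {κ : ℝ} {p q : ModelPlane κ} (h0 : p.coord 0 = q.coord 0)
    (h1 : p.coord 1 = q.coord 1) (h2 : p.coord 2 = q.coord 2) : p = q := by
  ext i
  fin_cases i
  · exact h0
  · exact h1
  · exact h2

theorem ModelPlane.coord_zero_of_eq {κ : ℝ} (h : κ = 0) (p : ModelPlane κ) : p.coord 0 = 1 := by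
  have h1 := p.form_self
  have h2 := p.pos h.le
  subst h
  simp only [modelForm, Real.sign_zero, zero_mul, add_zero] at h1
  nlinarith

theorem ModelPlane.sphere_eq_of_form {κ : ℝ} (h : 0 < κ) {p q : ModelPlane κ}
    (hpq : 1 ≤ modelForm κ p.coord q.coord) : p = q := by
  have hp := p.form_self
  have hq := q.form_self
  simp only [modelForm, Real.sign_of_pos h] at hp hq hpq
  have key : (p.coord 0 - q.coord 0) ^ 2 + (p.coord 1 - q.coord 1) ^ 2
      + (p.coord 2 - q.coord 2) ^ 2 ≤ 0 := by nlinarith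
  apply ModelPlane.ext_coord <;>
    nlinarith [sq_nonneg (p.coord 0 - q.coord 0), sq_nonneg (p.coord 1 - q.coord 1),
      sq_nonneg (p.coord 2 - q.coord 2)]

theorem ModelPlane.one_le_form {κ : ℝ} (h : κ < 0) (p q : ModelPlane κ) :
    1 ≤ modelForm κ p.coord q.coord := by
  have hp := p.form_self
  have hq := q.form_self
  have p0 := p.pos h.le
  have q0 := q.pos h.le
  simp only [modelForm, Real.sign_of_neg h] at hp hq ⊢
  have hp' : p.coord 0 ^ 2 = 1 + (p.coord 1 ^ 2 + p.coord 2 ^ 2) := by linarith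
  have hq' : q.coord 0 ^ 2 = 1 + (q.coord 1 ^ 2 + q.coord 2 ^ 2) := by linarith
  have : 1 + (p.coord 1 * q.coord 1 + p.coord 2 * q.coord 2) ≤ p.coord 0 * q.coord 0 := by
    apply le_of_sq_le_sq _ (mul_pos p0 q0).le
    rw [mul_pow, hp', hq']
    nlinarith [sq_nonneg (p.coord 1 - q.coord 1), sq_nonneg (p.coord 2 - q.coord 2),
      sq_nonneg (p.coord 1 * q.coord 2 - p.coord 2 * q.coord 1)]
  linarith

theorem ModelPlane.hyperbolic_eq_of_form {κ : ℝ} (h : κ < 0) {p q : ModelPlane κ}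
    (hpq : modelForm κ p.coord q.coord = 1) : p = q := by
  have hp := p.form_self
  have hq := q.form_self
  have p0 := p.pos h.le
  have q0 := q.pos h.le
  simp only [modelForm, Real.sign_of_neg h] at hp hq hpq
  have hp' : p.coord 0 ^ 2 = 1 + (p.coord 1 ^ 2 + p.coord 2 ^ 2) := by linarith
  have hq' : q.coord 0 ^ 2 = 1 + (q.coord 1 ^ 2 + q.coord 2 ^ 2) := by linarith
  have e : (p.coord 0 * q.coord 0) ^ 2
      = (1 + (p.coord 1 * q.coord 1 + p.coord 2 * q.coord 2)) ^ 2 := by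
    congr 1; linarith
  rw [mul_pow, hp', hq'] at e
  have s1 := sq_nonneg (p.coord 1 - q.coord 1)
  have s2 := sq_nonneg (p.coord 2 - q.coord 2)
  have s3 := sq_nonneg (p.coord 1 * q.coord 2 - p.coord 2 * q.coord 1)
  have e1 : p.coord 1 = q.coord 1 := by
    have : (p.coord 1 - q.coord 1) ^ 2 = 0 := by nlinarith
    exact sub_eq_zero.1 (pow_eq_zero_iff two_ne_zero |>.1 this)
  have e2 : p.coord 2 = q.coord 2 := by
    have : (p.coord 2 - q.coord 2) ^ 2 = 0 := by nlinarith
    exact sub_eq_zero.1 (pow_eq_zero_iff two_ne_zero |>.1 this)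
  refine ModelPlane.ext_coord ?_ e1 e2
  rw [e1, e2, ← hq'] at hp'
  exact (pow_left_inj₀ p0.le q0.le two_ne_zero).1 hp'

theorem modelDist_self (κ : ℝ) (p : ModelPlane κ) : modelDist κ p p = 0 := by
  unfold modelDist
  split_ifs <;> simp [p.form_self]

theorem modelDist_comm (κ : ℝ) (p q : ModelPlane κ) : modelDist κ p q = modelDist κ q p := by
  unfold modelDist
  rw [modelForm_comm κ p.coord q.coord, sub_sq_comm (p.coord 1), sub_sq_comm (p.coord 2)]

theorem eq_of_modelDist_eq_zero (κ : ℝ) {p q : ModelPlane κ} (h : modelDist κ p q = 0) :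
    p = q := by
  unfold modelDist at h
  split_ifs at h with h1 h2
  · rw [div_eq_zero_iff, or_iff_left (Real.sqrt_pos.2 h1).ne', Real.arccos_eq_zero] at h
    exact ModelPlane.sphere_eq_of_form h1 h
  · rw [Real.sqrt_eq_zero (by positivity)] at h
    refine ModelPlane.ext_coord ?_ ?_ ?_
    · rw [p.coord_zero_of_eq h2, q.coord_zero_of_eq h2]
    · nlinarith [sq_nonneg (p.coord 1 - q.coord 1), sq_nonneg (p.coord 2 - q.coord 2)]
    · nlinarith [sq_nonneg (p.coord 1 - q.coord 1), sq_nonneg (p.coord 2 - q.coord 2)]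
  · have h3 : κ < 0 := lt_of_le_of_ne (not_lt.1 h1) h2
    rw [div_eq_zero_iff, or_iff_left (Real.sqrt_pos.2 (neg_pos.2 h3)).ne',
      Real.arcosh_eq_zero_iff (ModelPlane.one_le_form h3 p q)] at h
    exact ModelPlane.hyperbolic_eq_of_form h3 h

theorem modelDist_triangle (κ : ℝ) (p q r : ModelPlane κ) :
    modelDist κ p r ≤ modelDist κ p q + modelDist κ q r := by
  have gram := modelForm_gram κ p q r
  unfold modelDist
  split_ifs with h1 h2
  · rw [← add_div]
    gcongr
    by_cases hπ : Real.arccos (modelForm κ p.coord q.coord)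
        + Real.arccos (modelForm κ q.coord r.coord) ≤ Real.pi
    · have bound : ∀ a b : ModelPlane κ, modelForm κ a.coord b.coord ∈ Set.Icc (-1) 1 := by
        intro a b
        have ha := a.form_self
        have hb := b.form_self
        simp only [modelForm, Real.sign_of_pos h1] at ha hb ⊢
        constructor
        · nlinarith [sq_nonneg (a.coord 0 + b.coord 0), sq_nonneg (a.coord 1 + b.coord 1),
            sq_nonneg (a.coord 2 + b.coord 2)]
        · nlinarith [sq_nonneg (a.coord 0 - b.coord 0), sq_nonneg (a.coord 1 - b.coord 1),
            sq_nonneg (a.coord 2 - b.coord 2)]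
      rw [← Real.arccos_cos (add_nonneg (Real.arccos_nonneg _) (Real.arccos_nonneg _)) hπ]
      apply Real.arccos_le_arccos
      rw [Real.cos_add, Real.cos_arccos (bound p q).1 (bound p q).2,
        Real.cos_arccos (bound q r).1 (bound q r).2, Real.sin_arccos, Real.sin_arccos,
        ← Real.sqrt_mul (by nlinarith [(bound p q).1, (bound p q).2])]
      have := Real.abs_le_sqrt (gram.trans_eq (by ring :
        _ = (1 - modelForm κ p.coord q.coord ^ 2) * (1 - modelForm κ q.coord r.coord ^ 2)))
      linarith [neg_abs_le (modelForm κ p.coord r.coord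
        - modelForm κ p.coord q.coord * modelForm κ q.coord r.coord)]
    · exact (Real.arccos_le_pi _).trans (not_le.1 hπ).le
  · have := dist_triangle !₂[p.coord 1, p.coord 2] !₂[q.coord 1, q.coord 2]
      !₂[r.coord 1, r.coord 2]
    simpa [EuclideanSpace.dist_eq, Fin.sum_univ_two, Real.dist_eq, sq_abs] using this
  · have h3 : κ < 0 := lt_of_le_of_ne (not_lt.1 h1) h2
    rw [← add_div]
    gcongr
    have a1 := ModelPlane.one_le_form h3 p q
    have b1 := ModelPlane.one_le_form h3 q r
    have c1 := ModelPlane.one_le_form h3 p r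
    rw [← Real.arcosh_cosh (add_nonneg (Real.arcosh_nonneg a1) (Real.arcosh_nonneg b1)),
      Real.arcosh_le_arcosh (by linarith) (Real.cosh_pos _), Real.cosh_add, Real.cosh_arcosh a1,
      Real.cosh_arcosh b1, Real.sinh_arcosh a1, Real.sinh_arcosh b1,
      ← Real.sqrt_mul (by nlinarith)]
    linarith [Real.abs_le_sqrt gram, le_abs_self (modelForm κ p.coord r.coord
        - modelForm κ p.coord q.coord * modelForm κ q.coord r.coord)]

noncomputable instance ModelPlane.instMetricSpace (κ : ℝ) : MetricSpace (ModelPlane κ) where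
  dist := modelDist κ
  dist_self := modelDist_self κ
  dist_comm := modelDist_comm κ
  dist_triangle := modelDist_triangle κ
  eq_of_dist_eq_zero := eq_of_modelDist_eq_zero κ

/-- The diameter `D_κ` of the model plane: `π / √κ` if `κ > 0`, and `∞` if `κ ≤ 0`. -/
noncomputable def modelDiam (κ : ℝ) : EReal :=
  if 0 < κ then ((Real.pi / √κ : ℝ) : EReal) else ⊤

/-! ### Geodesic segments and the `Cycl_n(κ)` condition -/

/-- `γ` is a geodesic from `x` to `y`: its restriction to `[0, d(x, y)]` is an isometric embedding
with `γ(0) = x` and `γ(d(x, y)) = y`. -/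
def IsGeodesicFromTo {M : Type*} [MetricSpace M] (x y : M) (γ : ℝ → M) : Prop :=
  (∀ s ∈ Set.Icc 0 (dist x y), ∀ t ∈ Set.Icc 0 (dist x y), dist (γ s) (γ t) = |s - t|) ∧
    γ 0 = x ∧ γ (dist x y) = y

/-- The geodesic segment `[x, y]`: the points on a geodesic from `x` to `y`. It is only meant for
points that are joined by exactly one geodesic segment (in the model plane: points at distance less
than `D_κ`), and it is the image of that geodesic then. -/
def geodesicSegment {M : Type*} [MetricSpace M] (x y : M) : Set M :=
  {p | ∃ γ : ℝ → M, IsGeodesicFromTo x y γ ∧ p ∈ γ '' Set.Icc 0 (dist x y)}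

/-- The perimeter `∑ i, d(f(i), f(i + 1))` of the closed polygon with vertices `f(i)`. -/
noncomputable def cyclicPerimeter {X : Type*} [MetricSpace X] {n : ℕ} [NeZero n]
    (f : ZMod n → X) : ℝ :=
  ∑ i : ZMod n, dist (f i) (f (i + 1))

/-- The `Cycl_n(κ)` condition (used for `n ≥ 4`) for a metric space `X`. -/
def IsCycl (n : ℕ) [NeZero n] (κ : ℝ) (X : Type*) [MetricSpace X] : Prop :=
  ∀ f : ZMod n → X, (cyclicPerimeter f : EReal) < 2 * modelDiam κ →
    ∃ g : ZMod n → ModelPlane κ,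
      (∀ i, dist (g i) (g (i + 1)) ≤ dist (f i) (f (i + 1))) ∧
      (∀ i j, j ≠ i + 1 → i ≠ j + 1 → dist (f i) (f j) ≤ dist (g i) (g j))

/-!
The polygon in the model plane is built by adding one vertex at a time. Suppose that the vertices
`f 0, …, f m` of a polygon in `X` already correspond to a convex polygon `x 0, …, x m` whose sides
have the right lengths and whose diagonals are not too short. The next vertex `f (m + 1)` is the apex
of a comparison triangle with base `[x 0, x m]`, which is glued to the polygon along this base. The
`Cycl₄(κ)` condition, applied to `f 0, f j, f m, f (m + 1)`, says that no path from `x j` through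
the base to the apex is shorter than the distance of `f j` and `f (m + 1)`
(`dist_le_add_of_diagonal`): points of the two diagonals of the quadrilateral in the model plane are
represented by combinations of their end points in `ℝ³`, and the Cauchy–Schwarz inequality, or the
reversed one for `κ < 0`, excludes that both diagonals are long.

It remains to straighten the glued figure to a convex polygon without shortening the distances
(`hasExtensions`). If all segments from the apex to the other vertices cross the base, the figure is
convex already. Otherwise it is reflex at an end of the base (`meet_or_reflex`), say at `x m`. Then
the sides `[x (m - 1), x m]` and `[x m, z]` are replaced by one side of the same total length. This
glues a triangle to the convex polygon `x 0, …, x (m - 1)`, which is dealt with by induction, and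
the vertex `x m` is put back on the straightened side (`exists_isExtension_of_reflex`). Alexandrov's
lemma (`exists_path_le`) shows that paths through the new base are no shorter than those through the
old one. All comparisons of distances rest on Stewart's theorem (`Btw.stewart`), by which the
distance from the apex of a triangle to a point of its base grows with the two other sides.

The model planes of all curvatures are treated together by means of the functions `sn`, `cs` and
`md`. Convexity of a polygon is expressed by the crossing of the diagonals of all quadrilaterals
spanned by vertices in cyclic order, which is meaningful for degenerate polygons too, and crossing is
expressed by the cones over the segments, so that it can be handled by linear algebra in `ℝ³`. For
`κ > 0` this needs that a quadrilateral of perimeter less than `2 D_κ` lies in an open half space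
(`exists_pos_functional`).
-/

namespace ModelPlane

/-! ### Trigonometry of constant curvature -/

/-- The generalized sine `sn_κ`, the solution of `y'' = -κ y`, `y 0 = 0`, `y' 0 = 1`. -/
noncomputable def sn (κ t : ℝ) : ℝ :=
  if 0 < κ then Real.sin (√κ * t) / √κ
  else if κ = 0 then t else Real.sinh (√(-κ) * t) / √(-κ)

/-- The modified distance function `md_κ t = ∫₀ᵗ sn_κ`. The generalized cosine is
`1 - κ * md_κ t`; unlike the cosine, `md_κ` still determines `t` when `κ = 0`. -/
noncomputable def md (κ t : ℝ) : ℝ :=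
  if 0 < κ then (1 - Real.cos (√κ * t)) / κ
  else if κ = 0 then t ^ 2 / 2 else (1 - Real.cosh (√(-κ) * t)) / κ

/-- The generalized cosine `cs_κ`. -/
noncomputable def cs (κ t : ℝ) : ℝ := 1 - κ * md κ t

/-- `r` is less than the diameter `D_κ` of the model plane. -/
def BelowDiam (κ r : ℝ) : Prop := 0 < κ → √κ * r < Real.pi

theorem sn_of_pos {κ : ℝ} (h : 0 < κ) (t : ℝ) : sn κ t = Real.sin (√κ * t) / √κ := by
  simp [sn, h]

theorem sn_of_zero (t : ℝ) : sn 0 t = t := by simp [sn]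

theorem sn_of_neg {κ : ℝ} (h : κ < 0) (t : ℝ) : sn κ t = Real.sinh (√(-κ) * t) / √(-κ) := by
  simp [sn, h.not_gt, h.ne]

theorem md_of_pos {κ : ℝ} (h : 0 < κ) (t : ℝ) : md κ t = (1 - Real.cos (√κ * t)) / κ := by
  simp [md, h]

theorem md_of_zero (t : ℝ) : md 0 t = t ^ 2 / 2 := by simp [md]

theorem md_of_neg {κ : ℝ} (h : κ < 0) (t : ℝ) : md κ t = (1 - Real.cosh (√(-κ) * t)) / κ := by
  simp [md, h.not_gt, h.ne]

theorem cs_of_pos {κ : ℝ} (h : 0 < κ) (t : ℝ) : cs κ t = Real.cos (√κ * t) := by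
  rw [cs, md_of_pos h]; field_simp; ring

theorem cs_of_zero (t : ℝ) : cs 0 t = 1 := by simp [cs]

theorem cs_of_neg {κ : ℝ} (h : κ < 0) (t : ℝ) : cs κ t = Real.cosh (√(-κ) * t) := by
  rw [cs, md_of_neg h]; field_simp [h.ne]; ring

@[simp] theorem sn_zero (κ : ℝ) : sn κ 0 = 0 := by simp [sn]

@[simp] theorem md_zero (κ : ℝ) : md κ 0 = 0 := by simp [md]

theorem md_neg (κ t : ℝ) : md κ (-t) = md κ t := by
  simp [md]

theorem sn_neg (κ t : ℝ) : sn κ (-t) = -sn κ t := by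
  unfold sn; split_ifs <;> simp [neg_div]

theorem sn_sq (κ t : ℝ) : sn κ t ^ 2 = 2 * md κ t - κ * md κ t ^ 2 := by
  rcases lt_trichotomy κ 0 with h | rfl | h
  · have hs := Real.sq_sqrt (neg_pos.2 h).le
    rw [sn_of_neg h, md_of_neg h, div_pow, hs, Real.sinh_sq]
    field_simp [h.ne]; ring
  · rw [sn_of_zero, md_of_zero]; ring
  · have hs := Real.sq_sqrt h.le
    rw [sn_of_pos h, md_of_pos h, div_pow, hs, Real.sin_sq]
    field_simp; ring

theorem sn_add (κ s t : ℝ) : sn κ (s + t) = sn κ s * cs κ t + cs κ s * sn κ t := by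
  rcases lt_trichotomy κ 0 with h | rfl | h
  · simp only [sn_of_neg h, cs_of_neg h, mul_add, Real.sinh_add]; ring
  · simp only [sn_of_zero, cs_of_zero]; ring
  · simp only [sn_of_pos h, cs_of_pos h, mul_add, Real.sin_add]; ring

theorem md_add (κ s t : ℝ) :
    md κ (s + t) = md κ s + md κ t - κ * md κ s * md κ t + sn κ s * sn κ t := by
  rcases lt_trichotomy κ 0 with h | rfl | h
  · have hs := Real.sq_sqrt (neg_pos.2 h).le
    have hp := Real.sqrt_pos.2 (neg_pos.2 h)
    simp only [sn_of_neg h, md_of_neg h, mul_add, Real.cosh_add]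
    rw [div_mul_div_comm, ← sq, hs]
    field_simp [h.ne]; ring
  · simp only [sn_of_zero, md_of_zero]; ring
  · have hs := Real.sq_sqrt h.le
    simp only [sn_of_pos h, md_of_pos h, mul_add, Real.cos_add]
    rw [div_mul_div_comm, ← sq, hs]
    field_simp; ring

theorem continuous_sn (κ : ℝ) : Continuous (sn κ) := by
  unfold sn; split_ifs <;> fun_prop

theorem BelowDiam.mono {κ r s : ℝ} (h : BelowDiam κ s) (hrs : r ≤ s) : BelowDiam κ r := fun hk =>
  (mul_le_mul_of_nonneg_left hrs (Real.sqrt_nonneg κ)).trans_lt (h hk)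

theorem sn_pos {κ t : ℝ} (ht : 0 < t) (h : BelowDiam κ t) : 0 < sn κ t := by
  rcases lt_trichotomy κ 0 with hk | rfl | hk
  · have hp := Real.sqrt_pos.2 (neg_pos.2 hk)
    rw [sn_of_neg hk]
    exact div_pos (Real.sinh_pos_iff.2 (by positivity)) hp
  · rwa [sn_of_zero]
  · have hp := Real.sqrt_pos.2 hk
    rw [sn_of_pos hk]
    exact div_pos (Real.sin_pos_of_pos_of_lt_pi (by positivity) (h hk)) hp

theorem sn_nonneg {κ t : ℝ} (ht : 0 ≤ t) (h : BelowDiam κ t) : 0 ≤ sn κ t := by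
  rcases ht.eq_or_lt with rfl | h0
  · simp
  · exact (sn_pos h0 h).le

/-- `md_κ` is increasing on `[0, D_κ]` and symmetric about `D_κ`; hence it is at least `md_κ s` on
`[s, 2 D_κ - s]`. -/
theorem md_lt_md {κ s t : ℝ} (hs : 0 ≤ s) (hst : s < t) (h : BelowDiam κ ((s + t) / 2)) :
    md κ s < md κ t := by
  rcases lt_trichotomy κ 0 with hk | rfl | hk
  · have hp := Real.sqrt_pos.2 (neg_pos.2 hk)
    rw [md_of_neg hk, md_of_neg hk, div_lt_div_right_of_neg hk]
    have : Real.cosh (√(-κ) * s) < Real.cosh (√(-κ) * t) := by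
      rw [Real.cosh_lt_cosh, abs_of_nonneg (by positivity),
        abs_of_nonneg (mul_nonneg hp.le (hs.trans hst.le))]
      exact mul_lt_mul_of_pos_left hst hp
    linarith
  · rw [md_of_zero, md_of_zero]; nlinarith
  · have hp := Real.sqrt_pos.2 hk
    have h1 := h hk
    rw [md_of_pos hk, md_of_pos hk]
    apply div_lt_div_of_pos_right _ hk
    have h3 : 0 < Real.cos (√κ * s) - Real.cos (√κ * t) := by
      rw [Real.cos_sub_cos]
      have a1 : 0 < Real.sin ((√κ * s + √κ * t) / 2) :=
        Real.sin_pos_of_pos_of_lt_pi (by nlinarith) (by linarith)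
      have a2 : 0 < Real.sin ((√κ * t - √κ * s) / 2) :=
        Real.sin_pos_of_pos_of_lt_pi (by nlinarith) (by nlinarith)
      have a3 : (√κ * s - √κ * t) / 2 = -((√κ * t - √κ * s) / 2) := by ring
      rw [a3, Real.sin_neg]
      nlinarith [mul_pos a1 a2]
    linarith

theorem md_le_md {κ s t : ℝ} (hs : 0 ≤ s) (hst : s ≤ t) (h : BelowDiam κ ((s + t) / 2)) :
    md κ s ≤ md κ t := by
  rcases hst.eq_or_lt with rfl | h1
  · rfl
  · exact (md_lt_md hs h1 h).le

/-! ### Distances in the model plane in terms of coordinates -/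

variable {κ : ℝ}

theorem sqrt_mul_dist_le (hk : 0 < κ) (x y : ModelPlane κ) : √κ * dist x y ≤ Real.pi := by
  have hp := Real.sqrt_pos.2 hk
  change √κ * modelDist κ x y ≤ _
  rw [modelDist, if_pos hk, mul_div_cancel₀ _ hp.ne']
  exact Real.arccos_le_pi _

theorem form_mem_Icc (hk : 0 < κ) (a b : ModelPlane κ) :
    modelForm κ a.coord b.coord ∈ Set.Icc (-1) 1 := by
  have ha := a.form_self
  have hb := b.form_self
  simp only [modelForm, Real.sign_of_pos hk] at ha hb ⊢
  constructor
  · nlinarith [sq_nonneg (a.coord 0 + b.coord 0), sq_nonneg (a.coord 1 + b.coord 1),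
      sq_nonneg (a.coord 2 + b.coord 2)]
  · nlinarith [sq_nonneg (a.coord 0 - b.coord 0), sq_nonneg (a.coord 1 - b.coord 1),
      sq_nonneg (a.coord 2 - b.coord 2)]

theorem form_eq_cs_dist (x y : ModelPlane κ) :
    modelForm κ x.coord y.coord = cs κ (dist x y) := by
  change _ = cs κ (modelDist κ x y)
  rcases lt_trichotomy κ 0 with hk | rfl | hk
  · have hp := Real.sqrt_pos.2 (neg_pos.2 hk)
    rw [cs_of_neg hk, modelDist, if_neg hk.not_gt, if_neg hk.ne, mul_div_cancel₀ _ hp.ne',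
      Real.cosh_arcosh (one_le_form hk x y)]
  · rw [cs_of_zero, modelForm, x.coord_zero_of_eq rfl, y.coord_zero_of_eq rfl]; simp
  · have hp := Real.sqrt_pos.2 hk
    rw [cs_of_pos hk, modelDist, if_pos hk, mul_div_cancel₀ _ hp.ne',
      Real.cos_arccos (form_mem_Icc hk x y).1 (form_mem_Icc hk x y).2]

theorem md_dist_of_zero (x y : ModelPlane 0) :
    md 0 (dist x y) = ((x.coord 1 - y.coord 1) ^ 2 + (x.coord 2 - y.coord 2) ^ 2) / 2 := by
  change md 0 (modelDist 0 x y) = _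
  rw [md_of_zero, modelDist, if_neg (lt_irrefl _), if_pos rfl, Real.sq_sqrt (by positivity)]

theorem belowDiam_half_of_dist {r s : ℝ} (x y : ModelPlane κ) (hr : r ≤ dist x y) (hs : s < r) :
    BelowDiam κ ((s + r) / 2) := fun hk => by
  have := sqrt_mul_dist_le hk x y
  have hp := Real.sqrt_pos.2 hk
  nlinarith

theorem dist_le_of_md_le {x y x' y' : ModelPlane κ}
    (h : md κ (dist x y) ≤ md κ (dist x' y')) : dist x y ≤ dist x' y' := by
  by_contra! hlt
  exact (md_lt_md dist_nonneg hlt (belowDiam_half_of_dist x y le_rfl hlt)).not_ge h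

theorem md_dist_le {x y : ModelPlane κ} {r : ℝ} (hr : 0 ≤ r) (h : r ≤ dist x y) :
    md κ r ≤ md κ (dist x y) := by
  rcases h.eq_or_lt with rfl | h1
  · rfl
  · refine md_le_md hr h fun hk => ?_
    have := sqrt_mul_dist_le hk x y
    have hp := Real.sqrt_pos.2 hk
    nlinarith

theorem md_dist_lt {x y : ModelPlane κ} {r : ℝ} (hr : 0 ≤ r) (h : r < dist x y) :
    md κ r < md κ (dist x y) := by
  refine md_lt_md hr h fun hk => ?_
  have := sqrt_mul_dist_le hk x y
  have hp := Real.sqrt_pos.2 hk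
  nlinarith

theorem dist_eq_of_md_eq {x y : ModelPlane κ} {r : ℝ} (hr : 0 ≤ r) (hD : BelowDiam κ r)
    (h : md κ (dist x y) = md κ r) : dist x y = r := by
  apply le_antisymm
  · by_contra! hlt
    exact (md_dist_lt hr hlt).ne' h
  · by_contra! hlt
    exact (md_lt_md dist_nonneg hlt (hD.mono (by linarith))).ne h

/-! ### Segments and Stewart's theorem -/

/-- `p` lies between `a` and `b`: the triangle inequality is an equality. -/
def Btw {M : Type*} [MetricSpace M] (a p b : M) : Prop := dist a p + dist p b = dist a b

theorem Btw.symm {M : Type*} [MetricSpace M] {a p b : M} (h : Btw a p b) : Btw b p a := by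
  unfold Btw at *
  rw [dist_comm b p, dist_comm p a, dist_comm b a, add_comm, h]

theorem btw_left {M : Type*} [MetricSpace M] (a b : M) : Btw a a b := by simp [Btw]

theorem btw_right {M : Type*} [MetricSpace M] (a b : M) : Btw a b b := by simp [Btw]

theorem cs_sq (κ t : ℝ) : cs κ t ^ 2 = 1 - κ * sn κ t ^ 2 := by
  rw [sn_sq, cs]; ring

theorem cs_add (κ s t : ℝ) : cs κ (s + t) = cs κ s * cs κ t - κ * (sn κ s * sn κ t) := by
  simp only [cs, md_add]; ring

theorem sn_combo_sq (κ s t : ℝ) :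
    sn κ t ^ 2 + sn κ s ^ 2 + 2 * sn κ t * sn κ s * cs κ (s + t) = sn κ (s + t) ^ 2 := by
  rw [cs_add, sn_add]
  linear_combination (-sn κ s ^ 2) * cs_sq κ t - sn κ t ^ 2 * cs_sq κ s

theorem form_combo_left (κ l m : ℝ) (a b x : Fin 3 → ℝ) :
    modelForm κ (fun i => l * a i + m * b i) x = l * modelForm κ a x + m * modelForm κ b x := by
  unfold modelForm; ring

theorem form_combo_right (κ l m : ℝ) (a b x : Fin 3 → ℝ) :
    modelForm κ x (fun i => l * a i + m * b i) = l * modelForm κ x a + m * modelForm κ x b := by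
  unfold modelForm; ring

theorem form_combo_self (κ l m : ℝ) (a b : ModelPlane κ) :
    modelForm κ (fun i => l * a.coord i + m * b.coord i) (fun i => l * a.coord i + m * b.coord i)
      = l ^ 2 + m ^ 2 + 2 * l * m * cs κ (dist a b) := by
  rw [form_combo_left, form_combo_right, form_combo_right, a.form_self, b.form_self,
    modelForm_comm κ b.coord, form_eq_cs_dist]
  ring

/-- The point dividing the segment `[a, b]` into pieces of lengths `s` and `t`, in coordinates. -/
theorem exists_coord_of_add_eq {a b : ModelPlane κ} {s t : ℝ} (hs : 0 ≤ s) (ht : 0 ≤ t)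
    (hst : s + t = dist a b) (hab : a ≠ b) (hD : BelowDiam κ (dist a b)) :
    ∃ p : ModelPlane κ, ∀ i, sn κ (s + t) * p.coord i = sn κ t * a.coord i + sn κ s * b.coord i := by
  have hL : 0 < sn κ (s + t) := by rw [hst]; exact sn_pos (dist_pos.2 hab) hD
  have hs0 : 0 ≤ sn κ s := sn_nonneg hs (hD.mono (by linarith))
  have ht0 : 0 ≤ sn κ t := sn_nonneg ht (hD.mono (by linarith))
  refine ⟨⟨fun i => sn κ t / sn κ (s + t) * a.coord i + sn κ s / sn κ (s + t) * b.coord i, ?_, ?_⟩,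
    fun i => ?_⟩
  · rw [form_combo_self, ← hst]
    have key := sn_combo_sq κ s t
    field_simp
    linarith
  · intro hk
    have pa := a.pos hk
    have pb := b.pos hk
    have : 0 < sn κ t * a.coord 0 + sn κ s * b.coord 0 := by
      rcases hs.eq_or_lt with rfl | h
      · have : 0 < sn κ t := by simpa using hL
        have := mul_pos this pa
        simpa using this
      · have := sn_pos h (hD.mono (by linarith))
        have := mul_nonneg ht0 pa.le
        have : 0 < sn κ s * b.coord 0 := by positivity
        linarith
    have e : sn κ t / sn κ (s + t) * a.coord 0 + sn κ s / sn κ (s + t) * b.coord 0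
      = (sn κ t * a.coord 0 + sn κ s * b.coord 0) / sn κ (s + t) := by ring
    rw [e]
    positivity
  · field_simp

theorem stewart_of_coord {a b p : ModelPlane κ} {s t : ℝ}
    (hst : s + t = dist a b) (hL : 0 < sn κ (s + t))
    (hp : ∀ i, sn κ (s + t) * p.coord i = sn κ t * a.coord i + sn κ s * b.coord i)
    (x : ModelPlane κ) :
    sn κ (s + t) * md κ (dist x p) =
      sn κ t * (md κ (dist x a) - md κ s) + sn κ s * (md κ (dist x b) - md κ t) := by
  by_cases hk : κ = 0
  · subst hk
    have hab := md_dist_of_zero a b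
    rw [← hst, md_of_zero] at hab
    simp only [md_dist_of_zero]
    simp only [md_of_zero]
    simp only [sn_of_zero] at *
    have e1 : p.coord 1 = (t * a.coord 1 + s * b.coord 1) / (s + t) := by
      rw [eq_div_iff hL.ne', mul_comm, hp 1]
    have e2 : p.coord 2 = (t * a.coord 2 + s * b.coord 2) / (s + t) := by
      rw [eq_div_iff hL.ne', mul_comm, hp 2]
    rw [e1, e2]
    field_simp
    linear_combination (2 * t * s) * hab
  · have hB : sn κ (s + t) * modelForm κ x.coord p.coord
        = sn κ t * modelForm κ x.coord a.coord + sn κ s * modelForm κ x.coord b.coord := by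
      rw [← form_combo_right, ← funext hp]
      unfold modelForm; ring
    simp only [form_eq_cs_dist] at hB
    have h1 := sn_add κ s t
    simp only [cs] at hB h1
    apply mul_left_cancel₀ hk
    linear_combination -hB + h1

theorem dist_eq_zero_of_md_eq_zero {x y : ModelPlane κ} (h : md κ (dist x y) = 0) : x = y := by
  apply dist_eq_zero.1
  exact dist_eq_of_md_eq le_rfl (fun _ => by simpa using Real.pi_pos) (by simpa using h)

theorem dist_of_coord {a b p : ModelPlane κ} {s t : ℝ} (hs : 0 ≤ s) (ht : 0 ≤ t)
    (hst : s + t = dist a b) (hL : 0 < sn κ (s + t)) (hD : BelowDiam κ (dist a b))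
    (hp : ∀ i, sn κ (s + t) * p.coord i = sn κ t * a.coord i + sn κ s * b.coord i) :
    dist a p = s ∧ dist p b = t := by
  have h1 := sn_add κ s t
  simp only [cs] at h1
  constructor
  · apply dist_eq_of_md_eq hs (hD.mono (by linarith))
    have h := stewart_of_coord hst hL hp a
    rw [dist_self, md_zero, ← hst, md_add] at h
    apply mul_left_cancel₀ hL.ne'
    have h2 := sn_sq κ s
    have h3 := sn_sq κ t
    rw [h, h1]
    linear_combination sn κ t * h2
  · rw [dist_comm]
    apply dist_eq_of_md_eq ht (hD.mono (by linarith))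
    have h := stewart_of_coord hst hL hp b
    rw [dist_self, md_zero, dist_comm b a, ← hst, md_add] at h
    apply mul_left_cancel₀ hL.ne'
    have h2 := sn_sq κ s
    have h3 := sn_sq κ t
    rw [h, h1]
    linear_combination sn κ s * h3

/-- A point between `a` and `b` is determined by its distances from them; this gives its
coordinates. -/
theorem Btw.coord {a b p : ModelPlane κ} (h : Btw a p b) (hab : a ≠ b)
    (hD : BelowDiam κ (dist a b)) (i : Fin 3) :
    sn κ (dist a b) * p.coord i = sn κ (dist p b) * a.coord i + sn κ (dist a p) * b.coord i := by
  have h' : dist a p + dist p b = dist a b := h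
  obtain ⟨q, hq⟩ := exists_coord_of_add_eq dist_nonneg dist_nonneg h' hab hD
  have hL : 0 < sn κ (dist a p + dist p b) := by rw [h']; exact sn_pos (dist_pos.2 hab) hD
  have hS := stewart_of_coord h' hL hq p
  rw [dist_comm p a, sub_self, sub_self, mul_zero, mul_zero, add_zero] at hS
  have := dist_eq_zero_of_md_eq_zero ((mul_eq_zero.1 hS).resolve_left hL.ne')
  subst this
  rw [← h']
  exact hq i

/-- **Stewart's theorem**: the distance from `x` to a point of the segment `[a, b]` in terms of the
distances from `x` to `a` and `b`. -/
theorem Btw.stewart {a b p : ModelPlane κ} (h : Btw a p b) (hD : BelowDiam κ (dist a b))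
    (x : ModelPlane κ) :
    sn κ (dist a b) * md κ (dist x p) =
      sn κ (dist p b) * (md κ (dist x a) - md κ (dist a p))
        + sn κ (dist a p) * (md κ (dist x b) - md κ (dist p b)) := by
  have h' : dist a p + dist p b = dist a b := h
  by_cases hab : a = b
  · subst hab
    have : dist a p = 0 := by
      have := dist_comm a p
      rw [dist_self] at h'
      linarith
    have e := dist_eq_zero.1 this
    subst e
    simp
  · have hL : 0 < sn κ (dist a p + dist p b) := by rw [h']; exact sn_pos (dist_pos.2 hab) hD
    rw [← h']
    exact stewart_of_coord h' hL (fun i => by rw [h']; exact h.coord hab hD i) x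

theorem exists_btw_of_add_eq {a b : ModelPlane κ} {s t : ℝ} (hs : 0 ≤ s) (ht : 0 ≤ t)
    (hst : s + t = dist a b) (hD : BelowDiam κ (dist a b)) :
    ∃ p : ModelPlane κ, dist a p = s ∧ dist p b = t := by
  by_cases hab : a = b
  · subst hab
    rw [dist_self] at hst
    exact ⟨a, by rw [dist_self]; linarith, by rw [dist_self]; linarith⟩
  · obtain ⟨p, hp⟩ := exists_coord_of_add_eq hs ht hst hab hD
    exact ⟨p, dist_of_coord hs ht hst (by rw [hst]; exact sn_pos (dist_pos.2 hab) hD) hD hp⟩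

/-- If the sides `[x, a]` and `[x, b]` of a triangle grow while `[a, b]` is kept, then so does the
distance from `x` to each point of `[a, b]`. -/
theorem dist_le_of_sides_le {a b p a' b' p' x x' : ModelPlane κ} (h : Btw a p b)
    (hD : BelowDiam κ (dist a b)) (ha : dist a' p' = dist a p) (hb : dist p' b' = dist p b)
    (hab : dist a' b' = dist a b) (hxa : dist x a ≤ dist x' a') (hxb : dist x b ≤ dist x' b') :
    dist x p ≤ dist x' p' := by
  have h' : Btw a' p' b' := by unfold Btw at *; rw [ha, hb, hab, h]
  by_cases hne : a = b
  · subst hne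
    have e : a' = b' := dist_eq_zero.1 (by rw [hab, dist_self])
    subst e
    unfold Btw at h h'
    rw [dist_self] at h h'
    have := dist_comm a p
    have := dist_comm a' p'
    have e1 : a = p := dist_eq_zero.1 (by linarith)
    have e2 : a' = p' := dist_eq_zero.1 (by linarith)
    rwa [← e1, ← e2]
  · have hL := sn_pos (dist_pos.2 hne) hD
    apply dist_le_of_md_le
    apply le_of_mul_le_mul_left _ hL
    have s1 := h.stewart hD x
    have s2 := h'.stewart (hab ▸ hD) x'
    rw [ha, hb, hab] at s2
    rw [s1, s2]
    have hle1 := dist_nonneg (x := p) (y := b)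
    have hle2 := dist_nonneg (x := a) (y := p)
    have hsum : dist a p + dist p b = dist a b := h
    have n1 : 0 ≤ sn κ (dist p b) := sn_nonneg dist_nonneg (hD.mono (by linarith))
    have n2 : 0 ≤ sn κ (dist a p) := sn_nonneg dist_nonneg (hD.mono (by linarith))
    have m1 := md_dist_le dist_nonneg hxa
    have m2 := md_dist_le dist_nonneg hxb
    gcongr

/-- The strict version of `dist_le_of_sides_le`, for a fixed segment `[a, b]`. -/
theorem dist_lt_of_side_lt {a b p x y : ModelPlane κ} (h : Btw a p b)
    (hD : BelowDiam κ (dist a b)) (hpb : p ≠ b) (hxa : dist x a < dist y a)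
    (hxb : dist x b ≤ dist y b) : dist x p < dist y p := by
  have hsum : dist a p + dist p b = dist a b := h
  have h1 := dist_pos.2 hpb
  have h2 := dist_nonneg (x := a) (y := p)
  have hL : 0 < sn κ (dist a b) := sn_pos (by linarith) hD
  by_contra! hle
  have s1 := h.stewart hD x
  have s2 := h.stewart hD y
  have n1 : 0 < sn κ (dist p b) := sn_pos h1 (hD.mono (by linarith))
  have n2 : 0 ≤ sn κ (dist a p) := sn_nonneg dist_nonneg (hD.mono (by linarith))
  have m1 := md_dist_lt dist_nonneg hxa
  have m2 := md_dist_le dist_nonneg hxb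
  have m3 := md_dist_le dist_nonneg hle
  have := mul_lt_mul_of_pos_left m1 n1
  have := mul_le_mul_of_nonneg_left m2 n2
  have := mul_le_mul_of_nonneg_left m3 hL.le
  nlinarith

/-! ### Cones over segments -/

/-- The cone over the segment `[a, b]` consists of the nonnegative combinations of `a` and `b`. -/
theorem exists_point_of_combo {a b : ModelPlane κ} (hD : BelowDiam κ (dist a b)) {l m : ℝ}
    (hl : 0 ≤ l) (hm : 0 ≤ m) (hlm : 0 < l + m) :
    ∃ (p : ModelPlane κ) (c : ℝ), 0 < c ∧ Btw a p b ∧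
      ∀ i, l * a.coord i + m * b.coord i = c * p.coord i := by
  by_cases hab : a = b
  · subst hab
    exact ⟨a, l + m, hlm, btw_left a a, fun i => by ring⟩
  have hL0 := dist_pos.2 hab
  have hL := sn_pos hL0 hD
  set L := dist a b with hLdef
  -- the point at distance `s` from `a` has coefficients proportional to `sn (L - s)` and `sn s`, and
  -- some `s` makes this ratio equal to `l : m`
  have hcont : ContinuousOn (fun s => l * sn κ s - m * sn κ (L - s)) (Set.Icc 0 L) := by
    have := continuous_sn κ
    fun_prop
  have hivt := intermediate_value_Icc hL0.le hcont
  have hz : (0 : ℝ) ∈ Set.Icc (l * sn κ 0 - m * sn κ (L - 0)) (l * sn κ L - m * sn κ (L - L)) := by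
    constructor
    · simp; positivity
    · simp; positivity
  obtain ⟨s, ⟨hs0, hsL⟩, hs⟩ := hivt hz
  simp only at hs
  have ht0 : 0 ≤ L - s := by linarith
  have hst : s + (L - s) = dist a b := by rw [← hLdef]; ring
  obtain ⟨p, hp⟩ := exists_coord_of_add_eq hs0 ht0 hst hab hD
  have hLe : s + (L - s) = L := by ring
  obtain ⟨d1, d2⟩ := dist_of_coord hs0 ht0 hst (by rwa [hLe]) hD hp
  rw [hLe] at hp
  have hS : 0 < sn κ s + sn κ (L - s) := by
    have n1 := sn_nonneg hs0 (hD.mono hsL)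
    have n2 := sn_nonneg ht0 (hD.mono (by linarith))
    rcases hs0.eq_or_lt with h | h
    · subst h
      simpa using hL
    · have := sn_pos h (hD.mono hsL)
      linarith
  refine ⟨p, (l + m) * sn κ L / (sn κ s + sn κ (L - s)), by positivity, ?_, fun i => ?_⟩
  · unfold Btw; rw [d1, d2, hst]
  · have := hp i
    have e : (l + m) * sn κ L / (sn κ s + sn κ (L - s)) * p.coord i
        = (l + m) * (sn κ L * p.coord i) / (sn κ s + sn κ (L - s)) := by ring
    rw [e, this, eq_div_iff hS.ne']
    linear_combination (a.coord i - b.coord i) * hs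

theorem form_smul_smul (κ c d : ℝ) (x y : Fin 3 → ℝ) :
    modelForm κ (fun i => c * x i) (fun i => d * y i) = c * d * modelForm κ x y := by
  unfold modelForm; ring

theorem eq_of_smul_coord_eq {p q : ModelPlane κ} {c d : ℝ} (hc : 0 < c) (hd : 0 < d)
    (h : ∀ i, c * p.coord i = d * q.coord i) : p = q := by
  have h1 : c ^ 2 * modelForm κ p.coord p.coord = d ^ 2 * modelForm κ q.coord q.coord := by
    rw [sq, sq, ← form_smul_smul, ← form_smul_smul, funext h]
  rw [p.form_self, q.form_self, mul_one, mul_one] at h1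
  have : c = d := (pow_left_inj₀ hc.le hd.le two_ne_zero).1 h1
  subst this
  ext i
  exact mul_left_cancel₀ hc.ne' (h i)

theorem btw_of_combo {a b p : ModelPlane κ} (hD : BelowDiam κ (dist a b)) {l m c : ℝ}
    (hl : 0 ≤ l) (hm : 0 ≤ m) (hlm : 0 < l + m) (hc : 0 < c)
    (h : ∀ i, c * p.coord i = l * a.coord i + m * b.coord i) : Btw a p b := by
  obtain ⟨q, d, hd, hq, hq'⟩ := exists_point_of_combo hD hl hm hlm
  rwa [eq_of_smul_coord_eq hc hd (fun i => (h i).trans (hq' i))]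

theorem Btw.exists_combo {a b p : ModelPlane κ} (h : Btw a p b) (hD : BelowDiam κ (dist a b)) :
    ∃ l m : ℝ, 0 ≤ l ∧ 0 ≤ m ∧ 0 < l + m ∧ ∀ i, p.coord i = l * a.coord i + m * b.coord i := by
  have h' : dist a p + dist p b = dist a b := h
  by_cases hab : a = b
  · subst hab
    have : dist a p = 0 := by
      have := dist_comm a p
      rw [dist_self] at h'
      linarith
    have e := dist_eq_zero.1 this
    subst e
    exact ⟨1, 0, by simp, by simp, by simp, by simp⟩
  · have hL := sn_pos (dist_pos.2 hab) hD
    have d1 := dist_nonneg (x := p) (y := b)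
    have d2 := dist_nonneg (x := a) (y := p)
    have n1 : 0 ≤ sn κ (dist p b) := sn_nonneg dist_nonneg (hD.mono (by linarith))
    have n2 : 0 ≤ sn κ (dist a p) := sn_nonneg dist_nonneg (hD.mono (by linarith))
    refine ⟨sn κ (dist p b) / sn κ (dist a b), sn κ (dist a p) / sn κ (dist a b),
      by positivity, by positivity, ?_, fun i => ?_⟩
    · rw [← add_div]
      refine div_pos ?_ hL
      rcases d2.eq_or_lt with h0 | h0
      · rw [← h0, zero_add] at h'
        rw [h']
        linarith
      · have := sn_pos h0 (hD.mono (by linarith))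
        linarith
    · have := h.coord hab hD i
      field_simp
      linarith

/-- A point between two points at distance less than `D_κ` lies on the geodesic segment. -/
theorem Btw.mem_geodesicSegment {a b p : ModelPlane κ} (h : Btw a p b)
    (hD : BelowDiam κ (dist a b)) : p ∈ geodesicSegment a b := by
  have hex : ∀ s : ℝ, ∃ q : ModelPlane κ, s ∈ Set.Icc 0 (dist a b) →
      dist a q = s ∧ dist q b = dist a b - s := by
    intro s
    by_cases hs : s ∈ Set.Icc 0 (dist a b)
    · obtain ⟨q, hq⟩ := exists_btw_of_add_eq hs.1 (sub_nonneg.2 hs.2) (by ring) hD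
      exact ⟨q, fun _ => hq⟩
    · exact ⟨a, fun h => absurd h hs⟩
  choose γ hγ using hex
  have hbtw : ∀ s ∈ Set.Icc 0 (dist a b), Btw a (γ s) b := by
    intro s hs
    have := hγ s hs
    unfold Btw; rw [this.1, this.2]; ring
  have huniq : ∀ q r : ModelPlane κ, Btw a q b → Btw a r b → dist a q = dist a r → q = r := by
    intro q r hq hr hqr
    apply dist_eq_zero.1
    apply le_antisymm _ dist_nonneg
    have e : dist q b = dist r b := by unfold Btw at hq hr; linarith
    have := dist_le_of_sides_le (x := q) (x' := r) hr hD rfl rfl rfl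
      (by rw [dist_comm q, dist_comm r, hqr]) e.le
    rwa [dist_self] at this
  have h' : dist a p + dist p b = dist a b := h
  have hmono : ∀ s ∈ Set.Icc 0 (dist a b), ∀ t ∈ Set.Icc 0 (dist a b), s ≤ t →
      dist (γ s) (γ t) = t - s := by
    intro s hs t ht hst
    -- the point at distance `s` from `a` on `[a, γ t]` is `γ s`
    obtain ⟨q, hq1, hq2⟩ := exists_btw_of_add_eq (a := a) (b := γ t) (s := s) (t := t - s) hs.1
      (sub_nonneg.2 hst) (by rw [(hγ t ht).1]; ring) (by rw [(hγ t ht).1]; exact hD.mono ht.2)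
    have hqb : Btw a q b := by
      have t1 := dist_triangle a q b
      have t2 := dist_triangle q (γ t) b
      rw [hq2, (hγ t ht).2] at t2
      unfold Btw
      linarith
    rw [← huniq q (γ s) hqb (hbtw s hs) (by rw [hq1, (hγ s hs).1]), hq2]
  have h0 : (0 : ℝ) ∈ Set.Icc 0 (dist a b) := ⟨le_rfl, dist_nonneg⟩
  have h1 : dist a b ∈ Set.Icc 0 (dist a b) := ⟨dist_nonneg, le_rfl⟩
  refine ⟨γ, ⟨fun s hs t ht => ?_, ?_, ?_⟩, dist a p, ⟨dist_nonneg, ?_⟩, ?_⟩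
  · rcases le_total s t with hst | hst
    · rw [hmono s hs t ht hst, abs_sub_comm, abs_of_nonneg (sub_nonneg.2 hst)]
    · rw [dist_comm, hmono t ht s hs hst, abs_of_nonneg (sub_nonneg.2 hst)]
  · exact (dist_eq_zero.1 (hγ 0 h0).1).symm
  · exact dist_eq_zero.1 (by rw [(hγ _ h1).2, sub_self])
  · have := dist_nonneg (x := p) (y := b)
    linarith
  · have hm : dist a p ∈ Set.Icc 0 (dist a b) := ⟨dist_nonneg, by
      have := dist_nonneg (x := p) (y := b)
      linarith⟩
    exact huniq _ _ (hbtw _ hm) h (hγ _ hm).1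

/-! ### Triangles with given sides -/

/-- The determinant of three vectors of `ℝ³`; its sign tells on which side of the line through `a`
and `b` the point `x` lies. -/
def side (a b x : Fin 3 → ℝ) : ℝ :=
  (a 1 * b 2 - a 2 * b 1) * x 0 + (a 2 * b 0 - a 0 * b 2) * x 1 + (a 0 * b 1 - a 1 * b 0) * x 2

/-- A vector orthogonal to `a` and `b` with respect to the form `modelForm κ`. For `κ = 0` it is the
vector `b - a` of the plane `x₀ = 0`, rotated by a right angle. -/
noncomputable def normal (κ : ℝ) (a b : Fin 3 → ℝ) : Fin 3 → ℝ :=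
  ![Real.sign κ * (a 1 * b 2 - a 2 * b 1), a 2 * b 0 - a 0 * b 2, a 0 * b 1 - a 1 * b 0]

theorem sign_mul_side_normal (a b : ModelPlane κ) :
    Real.sign κ * side a.coord b.coord (normal κ a.coord b.coord) = κ * sn κ (dist a b) ^ 2 := by
  have h := cs_sq κ (dist a b)
  rw [← form_eq_cs_dist] at h
  have ha := a.form_self
  have hb := b.form_self
  have key : Real.sign κ * side a.coord b.coord (normal κ a.coord b.coord)
      = modelForm κ a.coord a.coord * modelForm κ b.coord b.coord
        - modelForm κ a.coord b.coord ^ 2 := by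
    simp only [side, normal, modelForm, Matrix.cons_val]
    ring
  rw [key, ha, hb, h]; ring

theorem side_normal_pos {a b : ModelPlane κ} (hab : a ≠ b) (hD : BelowDiam κ (dist a b)) :
    0 < side a.coord b.coord (normal κ a.coord b.coord) := by
  have hL := sn_pos (dist_pos.2 hab) hD
  have hL2 : 0 < sn κ (dist a b) ^ 2 := by positivity
  rcases lt_trichotomy κ 0 with hk | rfl | hk
  · have := sign_mul_side_normal a b
    rw [Real.sign_of_neg hk] at this
    nlinarith
  · have h := md_dist_of_zero a b
    rw [md_of_zero] at h
    rw [sn_of_zero] at hL2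
    simp only [side, normal, Matrix.cons_val, Real.sign_zero, a.coord_zero_of_eq rfl,
      b.coord_zero_of_eq rfl]
    nlinarith
  · have := sign_mul_side_normal a b
    rw [Real.sign_of_pos hk] at this
    nlinarith [mul_pos hk hL2]

theorem coord_zero_pos_of_form (hk : κ < 0) (a : ModelPlane κ) {z : Fin 3 → ℝ}
    (hz : modelForm κ z z = 1) (haz : 0 < modelForm κ a.coord z) : 0 < z 0 := by
  by_contra! hz0
  have hz0' : z 0 ≠ 0 := by
    intro h0
    rw [modelForm, h0, Real.sign_of_neg hk] at hz
    nlinarith [sq_nonneg (z 1), sq_nonneg (z 2)]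
  -- `-z` lies on the upper sheet, on which the form is at least `1`
  let z' : ModelPlane κ := ⟨fun i => -z i, by rw [← hz]; unfold modelForm; ring, fun _ => by
    have : z 0 < 0 := lt_of_le_of_ne hz0 hz0'
    simpa using this⟩
  have h1 := one_le_form hk a z'
  have h2 : modelForm κ a.coord z'.coord = -modelForm κ a.coord z := by
    simp only [z', modelForm]; ring
  linarith

/-- A triangle with prescribed side lengths, built on a given side `[a, b]`, in either of the two
half planes: `ε` selects the half plane. -/
theorem exists_triangle {a b : ModelPlane κ} (hab : a ≠ b) {r s : ℝ} (hr : 0 ≤ r) (hs : 0 ≤ s)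
    (h1 : dist a b ≤ r + s) (h2 : r ≤ dist a b + s) (h3 : s ≤ dist a b + r)
    (hD : BelowDiam κ ((dist a b + r + s) / 2)) (ε : ℝ) :
    ∃ z : ModelPlane κ, dist a z = r ∧ dist b z = s ∧ 0 ≤ ε * side a.coord b.coord z.coord := by
  set c := dist a b with hc
  have hc0 : 0 < c := dist_pos.2 hab
  have hDc : BelowDiam κ c := hD.mono (by linarith)
  have hDr : BelowDiam κ r := hD.mono (by linarith)
  have hDs : BelowDiam κ s := hD.mono (by linarith)
  have hL := sn_pos hc0 hDc
  have hN := side_normal_pos hab hDc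
  -- Heron's formula: this product is the square of `sn c` times the `sn` of the altitude
  have hheron : 0 ≤ (md κ c - md κ (r - s)) * (md κ (r + s) - md κ c) := by
    apply mul_nonneg
    · rw [sub_nonneg]
      have : md κ (r - s) = md κ |r - s| := by
        rcases abs_choice (r - s) with h | h <;> rw [h]
        rw [md_neg]
      rw [this]
      have hle : |r - s| ≤ c := abs_le.2 ⟨by linarith, by linarith⟩
      exact md_le_md (abs_nonneg _) hle (hDc.mono (by linarith))
    · rw [sub_nonneg]
      exact md_le_md hc0.le h1 (hD.mono (by linarith))
  obtain ⟨e, he, hee⟩ : ∃ e : ℝ, e ^ 2 = 1 ∧ 0 ≤ ε * e := by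
    rcases le_total 0 ε with h | h
    · exact ⟨1, by norm_num, by linarith⟩
    · exact ⟨-1, by norm_num, by linarith⟩
  -- `A`, `B`, `C` are the coefficients of the apex with respect to `a`, `b` and the normal vector
  set S := sn κ c ^ 2 with hS
  have hS0 : 0 < S := by positivity
  have hSmd : S = 2 * md κ c - κ * md κ c ^ 2 := sn_sq κ c
  set A := (md κ s + md κ c - md κ r - κ * md κ c * md κ s) / S with hA
  set B := (md κ r + md κ c - md κ s - κ * md κ c * md κ r) / S with hB
  set C := e * √((md κ c - md κ (r - s)) * (md κ (r + s) - md κ c)) / S with hC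
  set n := normal κ a.coord b.coord with hn
  have hAS : A * S = md κ s + md κ c - md κ r - κ * md κ c * md κ s := by rw [hA]; field_simp
  have hBS : B * S = md κ r + md κ c - md κ s - κ * md κ c * md κ r := by rw [hB]; field_simp
  have hCS : C ^ 2 * S ^ 2 = (md κ c - md κ (r - s)) * (md κ (r + s) - md κ c) := by
    rw [hC, div_pow, mul_pow, he, Real.sq_sqrt hheron]; field_simp
  have hheron' : (md κ c - md κ (r - s)) * (md κ (r + s) - md κ c)
      = (2 * md κ r - κ * md κ r ^ 2) * (2 * md κ s - κ * md κ s ^ 2)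
        - (md κ r + md κ s - κ * md κ r * md κ s - md κ c) ^ 2 := by
    rw [sub_eq_add_neg r s, md_add, md_add, md_neg, sn_neg, ← sn_sq, ← sn_sq]; ring
  rw [hheron'] at hCS
  set z : Fin 3 → ℝ := fun i => A * a.coord i + B * b.coord i + C * n i with hz
  have hside : side a.coord b.coord z = C * side a.coord b.coord n := by
    simp only [hz, side]; ring
  have hsign : 0 ≤ ε * side a.coord b.coord z := by
    rw [hside, hC]
    have := Real.sqrt_nonneg ((md κ c - md κ (r - s)) * (md κ (r + s) - md κ c))
    have e1 : ε * (e * √((md κ c - md κ (r - s)) * (md κ (r + s) - md κ c)) / S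
        * side a.coord b.coord n) = (ε * e) * (√((md κ c - md κ (r - s)) * (md κ (r + s) - md κ c))
        * side a.coord b.coord n / S) := by ring
    rw [e1]
    positivity
  by_cases hk : κ = 0
  · subst hk
    have z0 : z 0 = 1 := by
      simp only [hz, hn, normal, Matrix.cons_val, Real.sign_zero, a.coord_zero_of_eq rfl,
        b.coord_zero_of_eq rfl]
      have : (A + B) * S = S := by rw [add_mul, hAS, hBS, hSmd]; ring
      have : A + B = 1 := by
        have := mul_right_cancel₀ hS0.ne' (this.trans (one_mul S).symm)
        exact this
      linarith
    have hcc := md_dist_of_zero a b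
    rw [← hc] at hcc
    have hab1 : A = 1 - B := by
      have : (A + B) * S = S := by rw [add_mul, hAS, hBS, hSmd]; ring
      have := mul_right_cancel₀ hS0.ne' (this.trans (one_mul S).symm)
      linarith
    refine ⟨⟨z, by simp [modelForm, z0], fun _ => by rw [z0]; exact one_pos⟩, ?_, ?_, hsign⟩
    · apply dist_eq_of_md_eq hr hDr
      rw [md_dist_of_zero]
      have : (a.coord 1 - z 1) ^ 2 + (a.coord 2 - z 2) ^ 2 = (B ^ 2 + C ^ 2) * S := by
        simp only [hz, hn, normal, Matrix.cons_val, a.coord_zero_of_eq rfl,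
          b.coord_zero_of_eq rfl, hab1, hSmd, hcc]
        ring
      simp only [this]
      apply mul_right_cancel₀ hS0.ne'
      have : (B ^ 2 + C ^ 2) * S / 2 * S = ((B * S) ^ 2 + C ^ 2 * S ^ 2) / 2 := by ring
      rw [this, hBS, hCS, hSmd]
      ring
    · apply dist_eq_of_md_eq hs hDs
      rw [md_dist_of_zero]
      have : (b.coord 1 - z 1) ^ 2 + (b.coord 2 - z 2) ^ 2 = (A ^ 2 + C ^ 2) * S := by
        have hB1 : B = 1 - A := by linarith
        simp only [hz, hn, normal, Matrix.cons_val, a.coord_zero_of_eq rfl,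
          b.coord_zero_of_eq rfl, hB1, hSmd, hcc]
        ring
      simp only [this]
      apply mul_right_cancel₀ hS0.ne'
      have : (A ^ 2 + C ^ 2) * S / 2 * S = ((A * S) ^ 2 + C ^ 2 * S ^ 2) / 2 := by ring
      rw [this, hAS, hCS, hSmd]
      ring
  · have hnn : modelForm κ n n = κ * S := by
      rw [hS, hc, ← sign_mul_side_normal a b]
      simp only [← hn]
      simp only [hn, modelForm, side, normal, Matrix.cons_val]
      ring
    have hna : modelForm κ a.coord n = 0 := by
      simp only [hn, modelForm, normal, Matrix.cons_val]; ring
    have hnb : modelForm κ b.coord n = 0 := by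
      simp only [hn, modelForm, normal, Matrix.cons_val]; ring
    have hab' : modelForm κ a.coord b.coord = 1 - κ * md κ c := by rw [form_eq_cs_dist, cs, hc]
    have hadd : ∀ x, modelForm κ x z
        = A * modelForm κ x a.coord + B * modelForm κ x b.coord + C * modelForm κ x n := by
      intro x; simp only [hz, modelForm]; ring
    have hza : modelForm κ a.coord z = 1 - κ * md κ r := by
      rw [hadd, a.form_self, hab', hna]
      apply mul_right_cancel₀ hS0.ne'
      have : (A * 1 + B * (1 - κ * md κ c) + C * 0) * S = A * S + B * S * (1 - κ * md κ c) := by ring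
      rw [this, hAS, hBS, hSmd]; ring
    have hzb : modelForm κ b.coord z = 1 - κ * md κ s := by
      rw [hadd, b.form_self, modelForm_comm, hab', hnb]
      apply mul_right_cancel₀ hS0.ne'
      have : (A * (1 - κ * md κ c) + B * 1 + C * 0) * S = A * S * (1 - κ * md κ c) + B * S := by ring
      rw [this, hAS, hBS, hSmd]; ring
    have hzn : modelForm κ n z = C * (κ * S) := by
      rw [hadd, modelForm_comm κ n, modelForm_comm κ n, hna, hnb, hnn]; ring
    have hzz : modelForm κ z z = 1 := by
      rw [hadd, modelForm_comm κ z, modelForm_comm κ z, modelForm_comm κ z, hza, hzb, hzn]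
      apply mul_right_cancel₀ hS0.ne'
      have : (A * (1 - κ * md κ r) + B * (1 - κ * md κ s) + C * (C * (κ * S))) * S
        = A * S * (1 - κ * md κ r) + B * S * (1 - κ * md κ s) + κ * (C ^ 2 * S ^ 2) := by ring
      rw [this, hAS, hBS, hCS, hSmd]; ring
    have hpos : κ ≤ 0 → 0 < z 0 := by
      intro hk0
      have hk' : κ < 0 := lt_of_le_of_ne hk0 hk
      have h3 : md κ 0 ≤ md κ r := md_le_md le_rfl hr (hDr.mono (by linarith))
      rw [md_zero] at h3
      refine coord_zero_pos_of_form hk' a hzz ?_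
      rw [hza]
      linarith [mul_nonpos_of_nonpos_of_nonneg hk0 h3]
    refine ⟨⟨z, hzz, hpos⟩, ?_, ?_, hsign⟩
    · apply dist_eq_of_md_eq hr hDr
      have := form_eq_cs_dist a ⟨z, hzz, hpos⟩
      rw [hza, cs] at this
      apply mul_left_cancel₀ hk
      linarith
    · apply dist_eq_of_md_eq hs hDs
      have := form_eq_cs_dist b ⟨z, hzz, hpos⟩
      rw [hzb, cs] at this
      apply mul_left_cancel₀ hk
      linarith

theorem coord_eq_neg_of_not_belowDiam {x y : ModelPlane κ} (h : ¬BelowDiam κ (dist x y)) (i : Fin 3) :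
    x.coord i = -y.coord i := by
  unfold BelowDiam at h
  push Not at h
  obtain ⟨hk, h⟩ := h
  have h1 : modelForm κ x.coord y.coord = -1 := by
    rw [form_eq_cs_dist, cs_of_pos hk, le_antisymm (sqrt_mul_dist_le hk x y) h, Real.cos_pi]
  have hx := x.form_self
  have hy := y.form_self
  simp only [modelForm, Real.sign_of_pos hk] at h1 hx hy
  have key : (x.coord 0 + y.coord 0) ^ 2 + (x.coord 1 + y.coord 1) ^ 2
      + (x.coord 2 + y.coord 2) ^ 2 = 0 := by linear_combination hx + hy + 2 * h1
  fin_cases i <;> simp <;>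
    nlinarith [sq_nonneg (x.coord 0 + y.coord 0), sq_nonneg (x.coord 1 + y.coord 1),
      sq_nonneg (x.coord 2 + y.coord 2)]

theorem exists_pair (κ : ℝ) : ∃ x y : ModelPlane κ, x ≠ y ∧ BelowDiam κ (dist x y) := by
  obtain ⟨u, v, huv, hu, hv⟩ : ∃ u v : ℝ, u ^ 2 + Real.sign κ * v ^ 2 = 1 ∧ 0 < u ∧ v ≠ 0 := by
    rcases lt_trichotomy κ 0 with hk | rfl | hk
    · exact ⟨5 / 4, 3 / 4, by rw [Real.sign_of_neg hk]; norm_num, by norm_num, by norm_num⟩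
    · exact ⟨1, 1, by simp, by norm_num, by norm_num⟩
    · exact ⟨4 / 5, 3 / 5, by rw [Real.sign_of_pos hk]; norm_num, by norm_num, by norm_num⟩
  let x : ModelPlane κ := ⟨![1, 0, 0], by simp [modelForm], fun _ => by simp⟩
  let y : ModelPlane κ := ⟨![u, v, 0], by simp [modelForm]; linarith, fun _ => by simpa⟩
  refine ⟨x, y, fun h => ?_, ?_⟩
  · have := congrArg (fun p => coord p 1) h
    simp [x, y] at this
    exact hv this.symm
  · by_contra h
    have := coord_eq_neg_of_not_belowDiam h 0
    simp [x, y] at this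
    linarith

theorem exists_dist_eq (b : ModelPlane κ) {r : ℝ} (hr : 0 ≤ r) (hD : BelowDiam κ r) :
    ∃ z : ModelPlane κ, dist b z = r := by
  obtain ⟨b', hne, hb'⟩ : ∃ b' : ModelPlane κ, b ≠ b' ∧ BelowDiam κ (dist b b') := by
    obtain ⟨x, y, hxy, hD⟩ := exists_pair κ
    by_cases h1 : b = x
    · exact ⟨y, h1 ▸ hxy, h1 ▸ hD⟩
    by_cases h2 : BelowDiam κ (dist b x)
    · exact ⟨x, h1, h2⟩
    refine ⟨y, fun h => h2 ?_, ?_⟩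
    · rwa [h, dist_comm]
    · by_contra h3
      apply hxy
      ext i
      have e1 := coord_eq_neg_of_not_belowDiam h2 i
      have e2 := coord_eq_neg_of_not_belowDiam h3 i
      linarith
  obtain ⟨z, hz, -⟩ := exists_triangle hne hr (abs_nonneg (dist b b' - r))
    (by linarith [le_abs_self (dist b b' - r)]) (by linarith [neg_abs_le (dist b b' - r)])
    (abs_le.2 ⟨by linarith [dist_nonneg (x := b) (y := b')],
      by linarith⟩)
    (by
      rcases abs_choice (dist b b' - r) with h | h <;> rw [h]
      · exact hb'.mono (by linarith)
      · exact hD.mono (by linarith)) 0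
  exact ⟨z, hz⟩

/-- The geodesic from `b` to `c` can be prolonged by the distance of `c` and `z`. -/
theorem exists_extension {b c z : ModelPlane κ} (hD : BelowDiam κ (dist b c + dist c z)) :
    ∃ v : ModelPlane κ, dist b v = dist b c + dist c z ∧ dist c v = dist c z := by
  by_cases h : b = c
  · exact ⟨z, by simp [h]⟩
  · have h1 := dist_nonneg (x := b) (y := c)
    have h2 := dist_nonneg (x := c) (y := z)
    obtain ⟨v, hv, hv', -⟩ := exists_triangle h (add_nonneg h1 h2) h2 (by linarith) (by linarith)
      (by linarith) (hD.mono (by linarith)) 0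
    exact ⟨v, hv, hv'⟩

/-! ### Four points and the diagonals of a quadrilateral -/

/-- The Cauchy–Schwarz inequality (reversed for `κ < 0`), applied to combinations of the end points
of two diagonals. -/
theorem not_diagonals_long (hk : κ ≠ 0) {a b c d : ModelPlane κ} {l m p q L U X Y Z : ℝ}
    (hl : 0 ≤ l) (hm : 0 ≤ m) (hlm : 0 < l + m) (hp : 0 ≤ p) (hq : 0 ≤ q) (hpq : 0 < p + q)
    (hL : 0 < L) (hU : 0 < U) (hX : 0 ≤ X) (hY : 0 ≤ Y) (hZ : 0 < Z)
    (hac : l ^ 2 + m ^ 2 + 2 * l * m * cs κ (dist a c) = L ^ 2 - κ * Y)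
    (hbd : p ^ 2 + q ^ 2 + 2 * p * q * cs κ (dist b d) = U ^ 2 - κ * Z)
    (h : p * (l * cs κ (dist b a) + m * cs κ (dist b c))
        + q * (l * cs κ (dist d a) + m * cs κ (dist d c)) = L * U + κ * X) : False := by
  have hPQ : modelForm κ (fun i => l * a.coord i + m * c.coord i)
      (fun i => p * b.coord i + q * d.coord i) = L * U + κ * X := by
    rw [← h, form_combo_left, form_combo_right, form_combo_right]
    simp only [form_eq_cs_dist, dist_comm a, dist_comm c]
    ring
  rw [← form_combo_self κ l m a c] at hac
  rw [← form_combo_self κ p q b d] at hbd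
  rcases hk.lt_or_gt with hk | hk
  · obtain ⟨P, k, hk0, -, hP⟩ := exists_point_of_combo (a := a) (b := c)
      (fun h => absurd h hk.not_gt) hl hm hlm
    obtain ⟨Q, r, hr0, -, hQ⟩ := exists_point_of_combo (a := b) (b := d)
      (fun h => absurd h hk.not_gt) hp hq hpq
    rw [funext hP, form_smul_smul, P.form_self] at hac
    rw [funext hQ, form_smul_smul, Q.form_self] at hbd
    rw [funext hP, funext hQ, form_smul_smul] at hPQ
    have hone := one_le_form hk P Q
    have c1 : L ≤ k := by
      apply le_of_sq_le_sq _ hk0.le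
      nlinarith
    have c2 : U < r := by
      apply lt_of_pow_lt_pow_left₀ 2 hr0.le
      nlinarith
    have c3 : k * r * modelForm κ P.coord Q.coord ≤ L * U := by nlinarith
    have c4 : L * U < k * r := mul_lt_mul' c1 c2 hU.le hk0
    have c5 : k * r ≤ k * r * modelForm κ P.coord Q.coord :=
      le_mul_of_one_le_right (by positivity) hone
    linarith
  · set P : Fin 3 → ℝ := fun i => l * a.coord i + m * c.coord i
    set Q : Fin 3 → ℝ := fun i => p * b.coord i + q * d.coord i
    have key : 0 ≤ modelForm κ (fun i => U * P i - L * Q i) (fun i => U * P i - L * Q i) := by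
      simp only [modelForm, Real.sign_of_pos hk]
      linarith [sq_nonneg (U * P 0 - L * Q 0), sq_nonneg (U * P 1 - L * Q 1),
        sq_nonneg (U * P 2 - L * Q 2)]
    have e : modelForm κ (fun i => U * P i - L * Q i) (fun i => U * P i - L * Q i)
        = U ^ 2 * modelForm κ P P + L ^ 2 * modelForm κ Q Q - 2 * (U * L) * modelForm κ P Q := by
      unfold modelForm; ring
    rw [e, hac, hbd, hPQ] at key
    have d1 : 0 ≤ κ * (U ^ 2 * Y) := by positivity
    have d2 : 0 < κ * (L ^ 2 * Z) := by positivity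
    have d3 : 0 ≤ κ * (U * L * X) := by positivity
    linarith

theorem not_diagonals_long_of_zero {a b c d : ModelPlane 0} {s t u v : ℝ} (hs : 0 ≤ s)
    (ht : 0 ≤ t) (hst : 0 < s + t) (hac : md 0 (s + t) ≤ md 0 (dist a c))
    (hu : 0 < u) (hv : 0 < v) (hbd : md 0 (u + v) < md 0 (dist b d))
    (hb : t * (md 0 (dist b a) - md 0 s) + s * (md 0 (dist b c) - md 0 t) ≤ (s + t) * md 0 u)
    (hd : t * (md 0 (dist d a) - md 0 s) + s * (md 0 (dist d c) - md 0 t) ≤ (s + t) * md 0 v) :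
    False := by
  simp only [md_dist_of_zero] at *
  simp only [md_of_zero] at *
  have hL : 0 < s + t := hst
  have hU : 0 < u + v := by linarith
  have k1 := sq_nonneg ((u + v) * (t * a.coord 1 + s * c.coord 1)
    - (s + t) * (v * b.coord 1 + u * d.coord 1))
  have k2 := sq_nonneg ((u + v) * (t * a.coord 2 + s * c.coord 2)
    - (s + t) * (v * b.coord 2 + u * d.coord 2))
  have h1 := mul_le_mul_of_nonneg_left hac (by positivity : 0 ≤ (u + v) ^ 2 * (t * s))
  have h2 := mul_lt_mul_of_pos_left hbd (by positivity : 0 < (s + t) ^ 2 * (v * u))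
  have h3 := mul_le_mul_of_nonneg_left hb (by positivity : 0 ≤ (s + t) * (u + v) * v)
  have h4 := mul_le_mul_of_nonneg_left hd (by positivity : 0 ≤ (s + t) * (u + v) * u)
  linarith

/-- If the diagonal `a c` is at least `s + t`, then `b d` is at most `u + v`, where `u` and `v` are at
least the distances that Stewart's theorem gives from `b` and `d` to the point dividing a segment of
length `s + t` into `s` and `t`. -/
theorem dist_le_add_of_diagonal_aux {a b c d : ModelPlane κ} {s t u v : ℝ} (hs : 0 ≤ s)
    (ht : 0 ≤ t) (hst : 0 < s + t) (hac : s + t ≤ dist a c) (hD : BelowDiam κ (s + t))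
    (hu : 0 < u) (hv : 0 < v)
    (hb : sn κ t * (md κ (dist b a) - md κ s) + sn κ s * (md κ (dist b c) - md κ t)
      ≤ sn κ (s + t) * md κ u)
    (hd : sn κ t * (md κ (dist d a) - md κ s) + sn κ s * (md κ (dist d c) - md κ t)
      ≤ sn κ (s + t) * md κ v) : dist b d ≤ u + v := by
  by_contra! hlt
  have hDU : BelowDiam κ (u + v) := fun hk => by
    have := sqrt_mul_dist_le hk b d
    have := Real.sqrt_pos.2 hk
    nlinarith
  have hL := sn_pos hst hD
  have hU := sn_pos (by linarith) hDU
  have nt : 0 ≤ sn κ t := sn_nonneg ht (hD.mono (by linarith))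
  have ns : 0 ≤ sn κ s := sn_nonneg hs (hD.mono (by linarith))
  have nu := sn_pos hu (hDU.mono (by linarith))
  have nv := sn_pos hv (hDU.mono (by linarith))
  have m1 := md_dist_le hst.le hac
  have m2 := md_dist_lt (by linarith) hlt
  have hlm : 0 < sn κ t + sn κ s := by
    rcases hs.eq_or_lt with rfl | h
    · simpa using hL
    · linarith [sn_pos h (hD.mono (by linarith))]
  have hadd1 := sn_add κ s t
  have hadd2 := sn_add κ u v
  have q1 := sn_combo_sq κ s t
  have q2 := sn_combo_sq κ u v
  by_cases hk : κ = 0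
  · subst hk
    simp only [sn_of_zero] at hb hd
    exact not_diagonals_long_of_zero hs ht hst m1 hu hv m2 hb hd
  · simp only [cs] at hadd1 hadd2 q1 q2
    refine not_diagonals_long hk nt ns hlm nv.le nu.le (by linarith) hL hU
      (X := sn κ v * (sn κ (s + t) * md κ u - (sn κ t * (md κ (dist b a) - md κ s)
        + sn κ s * (md κ (dist b c) - md κ t)))
        + sn κ u * (sn κ (s + t) * md κ v - (sn κ t * (md κ (dist d a) - md κ s)
        + sn κ s * (md κ (dist d c) - md κ t))))
      (Y := 2 * sn κ t * sn κ s * (md κ (dist a c) - md κ (s + t)))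
      (Z := 2 * sn κ v * sn κ u * (md κ (dist b d) - md κ (u + v))) ?_ ?_ ?_ ?_ ?_ ?_
      (a := a) (b := b) (c := c) (d := d)
    · have := mul_nonneg nv.le (sub_nonneg.2 hb)
      have := mul_nonneg nu.le (sub_nonneg.2 hd)
      linarith
    · have := sub_nonneg.2 m1
      positivity
    · have := sub_pos.2 m2
      positivity
    · simp only [cs]
      linear_combination q1
    · simp only [cs]
      linear_combination q2
    · simp only [cs]
      linear_combination (-sn κ v - sn κ u) * hadd1 - sn κ (s + t) * hadd2

/-- A quadrilateral `a' b' c' d'` whose sides are at most those of `a b c d` and whose diagonal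
`a' c'` is at least `a c` has its other diagonal bounded by each path from `b` to `d` through a
point of `[a, c]`. The triangles `a b c` and `a d c` may lie on either side of `[a, c]`. -/
theorem dist_le_add_of_diagonal {a b c d q a' b' c' d' : ModelPlane κ} (hq : Btw a q c)
    (hD : BelowDiam κ (dist a c)) (hac : dist a c ≤ dist a' c') (hba : dist b' a' ≤ dist b a)
    (hbc : dist b' c' ≤ dist b c) (hda : dist d' a' ≤ dist d a) (hdc : dist d' c' ≤ dist d c) :
    dist b' d' ≤ dist b q + dist q d := by
  have hsum : dist a q + dist q c = dist a c := hq
  have n1 := dist_nonneg (x := a) (y := q)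
  have n2 := dist_nonneg (x := q) (y := c)
  rcases eq_or_ne a c with rfl | hne
  · have : dist a q = 0 := by
      rw [dist_self, dist_comm q] at hsum; linarith
    have e := dist_eq_zero.1 this
    subst e
    linarith [dist_triangle b' a' d', dist_comm d' a', dist_comm d a]
  have hst : 0 < dist a q + dist q c := by rw [hsum]; exact dist_pos.2 hne
  have hL := sn_pos (dist_pos.2 hne) hD
  have nt : 0 ≤ sn κ (dist q c) := sn_nonneg n2 (hD.mono (by linarith))
  have ns : 0 ≤ sn κ (dist a q) := sn_nonneg n1 (hD.mono (by linarith))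
  by_contra! hlt
  -- both `dist b q` and `dist q d` are enlarged by `e`, which makes them positive
  set e := (dist b' d' - (dist b q + dist q d)) / 4 with he
  have he0 : 0 < e := by rw [he]; linarith
  have hbel : ∀ r, r ≤ dist b q + dist q d → BelowDiam κ (r + e / 2) := fun r hr hk => by
    have h1 := sqrt_mul_dist_le hk b' d'
    have h2 := Real.sqrt_pos.2 hk
    have h3 : r + e / 2 < dist b' d' := by linarith
    nlinarith
  have p1 := dist_nonneg (x := b) (y := q)
  have p2 := dist_nonneg (x := q) (y := d)
  have step : ∀ x x' : ModelPlane κ, dist x' a' ≤ dist x a → dist x' c' ≤ dist x c →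
      dist x q ≤ dist b q + dist q d →
      sn κ (dist q c) * (md κ (dist x' a') - md κ (dist a q))
        + sn κ (dist a q) * (md κ (dist x' c') - md κ (dist q c))
      ≤ sn κ (dist a q + dist q c) * md κ (dist x q + e) := by
    intro x x' h1 h2 h3
    have st := hq.stewart hD x
    have m1 := md_dist_le dist_nonneg h1
    have m2 := md_dist_le dist_nonneg h2
    have m3 : md κ (dist x q) ≤ md κ (dist x q + e) :=
      md_le_md dist_nonneg (by linarith) ((hbel _ h3).mono (by linarith))
    calc _ ≤ sn κ (dist q c) * (md κ (dist x a) - md κ (dist a q))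
        + sn κ (dist a q) * (md κ (dist x c) - md κ (dist q c)) := by gcongr
      _ = sn κ (dist a c) * md κ (dist x q) := st.symm
      _ ≤ _ := by rw [hsum]; gcongr
  have := dist_le_add_of_diagonal_aux (a := a') (b := b') (c := c') (d := d') n1 n2 hst
    (by rw [hsum]; exact hac) (by rw [hsum]; exact hD) (u := dist b q + e) (v := dist d q + e)
    (by linarith) (by linarith [dist_nonneg (x := d) (y := q)])
    (step b b' hba hbc (by linarith)) (step d d' hda hdc (by rw [dist_comm d q]; linarith))
  rw [dist_comm d q] at this
  linarith

/-! ### Quadrilaterals lie in an open half space -/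

theorem belowDiam_of_pos (φ : (Fin 3 → ℝ) →ₗ[ℝ] ℝ) {x y : ModelPlane κ} (hx : 0 < φ x.coord)
    (hy : 0 < φ y.coord) : BelowDiam κ (dist x y) := by
  by_contra h
  have e : x.coord = -y.coord := funext fun i => coord_eq_neg_of_not_belowDiam h i
  rw [e, map_neg] at hx
  linarith

/-- The linear functional `x ↦ modelForm κ v x`. -/
noncomputable def formLinear (κ : ℝ) (v : Fin 3 → ℝ) : (Fin 3 → ℝ) →ₗ[ℝ] ℝ where
  toFun := modelForm κ v
  map_add' x y := by simp only [modelForm, Pi.add_apply]; ring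
  map_smul' c x := by
    simp only [modelForm, Pi.smul_apply, smul_eq_mul, RingHom.id_apply]; ring

theorem form_add_pos (hk : 0 < κ) {a m x : ModelPlane κ} (h : BelowDiam κ (dist a x + dist m x)) :
    0 < formLinear κ (a.coord + m.coord) x.coord := by
  have e : formLinear κ (a.coord + m.coord) x.coord
      = modelForm κ a.coord x.coord + modelForm κ m.coord x.coord := by
    change modelForm κ _ _ = _
    simp only [modelForm, Pi.add_apply]; ring
  rw [e, form_eq_cs_dist, form_eq_cs_dist, cs_of_pos hk, cs_of_pos hk]
  have h1 := h hk
  have hp := Real.sqrt_pos.2 hk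
  have := Real.cos_lt_cos_of_nonneg_of_le_pi (x := √κ * dist a x)
    (y := Real.pi - √κ * dist m x) (by positivity)
    (by linarith [mul_nonneg hp.le (dist_nonneg (x := m) (y := x))]) (by linarith)
  rw [Real.cos_pi_sub] at this
  linarith

theorem exists_pos_functional_aux (hk : 0 < κ) {a b c d : ModelPlane κ} {r : ℝ}
    (hr : dist a b + dist b c + dist c d + dist d a = 2 * r) (hD : BelowDiam κ r)
    (hle : r ≤ dist a b + dist b c) :
    ∃ φ : (Fin 3 → ℝ) →ₗ[ℝ] ℝ, 0 < φ a.coord ∧ 0 < φ b.coord ∧ 0 < φ c.coord ∧ 0 < φ d.coord := by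
  have hab : dist a b ≤ r := by
    linarith [dist_triangle4 a d c b, dist_comm a d, dist_comm d c, dist_comm c b]
  have hbc : dist b c ≤ r := by
    linarith [dist_triangle4 b a d c, dist_comm b a, dist_comm a d, dist_comm d c]
  -- `m` halves the perimeter, starting from `a`
  obtain ⟨m, hm1, hm2⟩ := exists_btw_of_add_eq (a := b) (b := c) (s := r - dist a b)
    (t := dist b c - (r - dist a b)) (by linarith) (by linarith) (by ring) (hD.mono hbc)
  have t1 := dist_triangle a b m
  have t2 := dist_triangle a d c
  have t3 := dist_triangle m c d
  have c1 := dist_comm a m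
  have c2 := dist_comm b m
  have c3 := dist_comm a d
  have c4 := dist_comm d c
  refine ⟨formLinear κ (a.coord + m.coord), form_add_pos hk (hD.mono ?_),
    form_add_pos hk (hD.mono ?_), form_add_pos hk (hD.mono ?_), form_add_pos hk (hD.mono ?_)⟩
  · rw [dist_self]; linarith
  · linarith
  · linarith
  · linarith

/-- A closed quadrilateral of perimeter less than `2 D_κ` lies in an open half space of `ℝ³` bounded
by a plane through the origin. -/
theorem exists_pos_functional {a b c d : ModelPlane κ}
    (hD : BelowDiam κ ((dist a b + dist b c + dist c d + dist d a) / 2)) :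
    ∃ φ : (Fin 3 → ℝ) →ₗ[ℝ] ℝ, 0 < φ a.coord ∧ 0 < φ b.coord ∧ 0 < φ c.coord ∧ 0 < φ d.coord := by
  by_cases hk : 0 < κ
  · rcases le_total ((dist a b + dist b c + dist c d + dist d a) / 2) (dist a b + dist b c)
      with h | h
    · exact exists_pos_functional_aux hk (by ring) hD h
    · obtain ⟨φ, h1, h2, h3, h4⟩ := exists_pos_functional_aux hk (a := a) (b := d) (c := c) (d := b)
        (r := (dist a b + dist b c + dist c d + dist d a) / 2)
        (by rw [dist_comm a d, dist_comm d c, dist_comm c b, dist_comm b a]; ring) hD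
        (by rw [dist_comm a d, dist_comm d c]; linarith)
      exact ⟨φ, h1, h4, h3, h2⟩
  · exact ⟨LinearMap.proj 0, a.pos (not_lt.1 hk), b.pos (not_lt.1 hk), c.pos (not_lt.1 hk),
      d.pos (not_lt.1 hk)⟩

/-! ### Crossing segments -/

/-- A nontrivial nonnegative combination of `a` and `c` equals one of `b` and `d`. If both pairs have
distance less than `D_κ`, this means that the segments `[a, c]` and `[b, d]` meet. -/
def Meet (a c b d : ModelPlane κ) : Prop :=
  ∃ s t u v : ℝ, 0 ≤ s ∧ 0 ≤ t ∧ 0 ≤ u ∧ 0 ≤ v ∧ 0 < s + t ∧ 0 < u + v ∧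
    ∀ i, s * a.coord i + t * c.coord i = u * b.coord i + v * d.coord i

theorem Meet.comm {a c b d : ModelPlane κ} (h : Meet a c b d) : Meet b d a c := by
  obtain ⟨s, t, u, v, hs, ht, hu, hv, hst, huv, h⟩ := h
  exact ⟨u, v, s, t, hu, hv, hs, ht, huv, hst, fun i => (h i).symm⟩

theorem Meet.swap_left {a c b d : ModelPlane κ} (h : Meet a c b d) : Meet c a b d := by
  obtain ⟨s, t, u, v, hs, ht, hu, hv, hst, huv, h⟩ := h
  exact ⟨t, s, u, v, ht, hs, hu, hv, by linarith, huv, fun i => by linarith [h i]⟩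

theorem Meet.swap_right {a c b d : ModelPlane κ} (h : Meet a c b d) : Meet a c d b :=
  h.comm.swap_left.comm

theorem meet_of_left_eq (a c d : ModelPlane κ) : Meet a c a d :=
  ⟨1, 0, 1, 0, by simp⟩

theorem Meet.exists_btw {a c b d : ModelPlane κ} (h : Meet a c b d) (hac : BelowDiam κ (dist a c))
    (hbd : BelowDiam κ (dist b d)) : ∃ p, Btw a p c ∧ Btw b p d := by
  obtain ⟨s, t, u, v, hs, ht, hu, hv, hst, huv, h⟩ := h
  obtain ⟨p, k, hk, hp, hp'⟩ := exists_point_of_combo hac hs ht hst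
  exact ⟨p, hp, btw_of_combo hbd hu hv huv hk fun i => (hp' i).symm.trans (h i)⟩

/-- If a segment `[i, k]` meets the sides `[a, j]` and `[b, j]` of a triangle, then it meets `[p, j]`
for every point `p` of the third side. -/
theorem Meet.of_combo {a b j i k p : ModelPlane κ} (ha : Meet a j i k) (hb : Meet b j i k)
    {l m c : ℝ} (hl : 0 ≤ l) (hm : 0 ≤ m) (hlm : 0 < l + m) (hc : 0 < c)
    (hp : ∀ n, c * p.coord n = l * a.coord n + m * b.coord n) : Meet p j i k := by
  obtain ⟨s, t, u, v, hs, ht, hu, hv, hst, huv, h⟩ := ha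
  obtain ⟨s', t', u', v', hs', ht', hu', hv', hst', huv', h'⟩ := hb
  rcases hs.eq_or_lt with rfl | hs
  · exact ⟨0, t, u, v, le_rfl, ht, hu, hv, hst, huv, fun n => by linarith [h n]⟩
  rcases hs'.eq_or_lt with rfl | hs'
  · exact ⟨0, t', u', v', le_rfl, ht', hu', hv', hst', huv', fun n => by linarith [h' n]⟩
  refine ⟨s * s' * c, l * s' * t + m * s * t', l * s' * u + m * s * u', l * s' * v + m * s * v',
    by positivity, by positivity, by positivity, by positivity, ?_, ?_, fun n => ?_⟩
  · have : 0 ≤ l * s' * t + m * s * t' := by positivity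
    have : 0 < s * s' * c := by positivity
    linarith
  · have e : l * s' * u + m * s * u' + (l * s' * v + m * s * v')
        = l * (s' * (u + v)) + m * (s * (u' + v')) := by ring
    rw [e]
    have h1 : 0 < s' * (u + v) := by positivity
    have h2 : 0 < s * (u' + v') := by positivity
    rcases hl.eq_or_lt with rfl | hl
    · have : 0 < m := by linarith
      positivity
    · positivity
  · linear_combination (s * s') * hp n + (l * s') * h n + (m * s) * h' n

theorem Meet.of_btw {a b j i k p : ModelPlane κ} (ha : Meet a j i k) (hb : Meet b j i k)
    (hp : Btw a p b) (hD : BelowDiam κ (dist a b)) : Meet p j i k := by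
  obtain ⟨l, m, hl, hm, hlm, h⟩ := hp.exists_combo hD
  exact ha.of_combo hb hl hm hlm one_pos fun n => by rw [one_mul]; exact h n

/-! ### Reflex vertices -/

/-- The quadrilateral `a b c z` with diagonal `[a, c]` is reflex at `c`: prolonging `[b, c]` beyond
`c` by the length of `[c, z]` leads to a point which is not farther from `a` than `z`. In terms of
the angles at `c`: `∠ b c a + ∠ a c z ≥ π`. -/
def Reflex (a c b z : ModelPlane κ) : Prop :=
  ∃ v, dist b v = dist b c + dist c z ∧ dist c v = dist c z ∧ dist a v ≤ dist a z

theorem reflex_of_combo {a b c z : ModelPlane κ} (hac : a ≠ c)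
    (hD : BelowDiam κ ((dist a b + dist b c + dist c z + dist z a) / 2))
    (φ : (Fin 3 → ℝ) →ₗ[ℝ] ℝ) (pa : 0 < φ a.coord) (pb : 0 < φ b.coord) (pc : 0 < φ c.coord)
    (pz : 0 < φ z.coord) {l m r s : ℝ} (hl : 0 ≤ l) (hm : 0 ≤ m) (hlm : 0 < l + m) (hr : 0 < r)
    (hs : 0 < s) (h : ∀ i, l * z.coord i + m * b.coord i + r * a.coord i = s * c.coord i) :
    Reflex a c b z := by
  have hbz := belowDiam_of_pos φ pb pz
  have hzb := belowDiam_of_pos φ pz pb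
  have haz := belowDiam_of_pos φ pa pz
  have pos_of : ∀ {k l m : ℝ} {x y p : ModelPlane κ}, 0 < k → 0 ≤ l → 0 ≤ m → 0 < l + m →
      0 < φ x.coord → 0 < φ y.coord →
      (∀ i, l * x.coord i + m * y.coord i = k * p.coord i) → 0 < φ p.coord := by
    intro k l m x y p hk hl hm hlm hx hy h
    have e : l • x.coord + m • y.coord = k • p.coord := funext h
    have e' := congrArg φ e
    simp only [map_add, map_smul, smul_eq_mul] at e'
    refine pos_of_mul_pos_right ?_ hk.le
    rw [← e']
    rcases hl.eq_or_lt with rfl | hl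
    · have : 0 < m := by linarith
      positivity
    · positivity
  -- `q` is the point where `[z, b]` meets the line through `a` and `c`, and `c` lies in `[a, q]`
  obtain ⟨q, k, hk, hzq, hq⟩ := exists_point_of_combo hzb hl hm hlm
  have pq := pos_of hk hl hm hlm pz pb hq
  have haq := belowDiam_of_pos φ pa pq
  have hacq : Btw a c q := btw_of_combo haq (l := r) (m := k) (c := s) hr.le hk.le (by linarith) hs
    fun i => by linarith [h i, hq i]
  have hcq : c ≠ q := by
    rintro rfl
    have e : ∀ i, r * a.coord i = (s - k) * c.coord i := fun i => by linarith [h i, hq i]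
    have hsk : 0 < s - k := by
      have e1 : r • a.coord = (s - k) • c.coord := funext e
      have e2 := congrArg φ e1
      simp only [map_smul, smul_eq_mul] at e2
      refine pos_of_mul_pos_left ?_ pc.le
      rw [← e2]; positivity
    exact hac (eq_of_smul_coord_eq hr hsk e)
  -- `c` lies in the triangle `a b z`, so the path via `c` is shorter than the one via `a`
  have hlen : dist b c + dist c z ≤ dist b a + dist a z := by
    obtain ⟨y, k', hk', hy, hy'⟩ := exists_point_of_combo haz hr.le hl (by linarith)
    have py := pos_of hk' hr.le hl (by linarith) pa pz hy'
    have hbcy : Btw b c y := btw_of_combo (belowDiam_of_pos φ pb py) hm hk'.le (by linarith) hs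
      fun i => by linarith [h i, hy' i]
    unfold Btw at hy hbcy
    linarith [dist_triangle c y z, dist_triangle b a y]
  have hDbc : BelowDiam κ (dist b c + dist c z) :=
    hD.mono (by linarith [dist_comm b a, dist_comm a z])
  obtain ⟨v, hv1, hv2⟩ := exists_extension hDbc
  refine ⟨v, hv1, hv2, ?_⟩
  by_contra! hlt
  -- otherwise `v` is nearer to `q` than `z`, and the path from `b` to `v` via `q` is too short
  have hqv : dist v q < dist z q := by
    by_contra! hle
    have := dist_lt_of_side_lt hacq haq hcq (x := z) (y := v)
      (by rwa [dist_comm z a, dist_comm v a]) hle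
    rw [dist_comm z c, dist_comm v c, hv2] at this
    exact lt_irrefl _ this
  have hbq := hzq.symm
  unfold Btw at hbq
  linarith [dist_triangle b q v, dist_comm v q, dist_comm z q, dist_triangle b c z]

/-- If `b` and `z` lie on opposite sides of the line through `a` and `c`, then `[b, z]` crosses
`[a, c]` or the quadrilateral `a b c z` is reflex at one of the ends of this diagonal. -/
theorem meet_or_reflex {a b c z : ModelPlane κ} (hac : a ≠ c)
    (hD : BelowDiam κ ((dist a b + dist b c + dist c z + dist z a) / 2))
    (hside : side a.coord c.coord b.coord * side a.coord c.coord z.coord ≤ 0) :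
    Meet a c b z ∨ Reflex a c b z ∨ Reflex c a b z := by
  obtain ⟨φ, pa, pb, pc, pz⟩ := exists_pos_functional hD
  obtain ⟨l, m, hl, hm, hlm, hV⟩ : ∃ l m : ℝ, 0 ≤ l ∧ 0 ≤ m ∧ 0 < l + m ∧
      l * side a.coord c.coord z.coord + m * side a.coord c.coord b.coord = 0 := by
    by_cases hz : side a.coord c.coord z.coord = 0
    · exact ⟨1, 0, by norm_num, le_rfl, by norm_num, by simp [hz]⟩
    · refine ⟨|side a.coord c.coord b.coord|, |side a.coord c.coord z.coord|, abs_nonneg _,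
        abs_nonneg _, by positivity, ?_⟩
      rcases lt_or_gt_of_ne hz with h | h
      · have hb : 0 ≤ side a.coord c.coord b.coord := by
          by_contra! hb
          exact hside.not_gt (mul_pos_of_neg_of_neg hb h)
        rw [abs_of_neg h, abs_of_nonneg hb]; ring
      · have hb : side a.coord c.coord b.coord ≤ 0 := by
          by_contra! hb
          exact hside.not_gt (mul_pos hb h)
        rw [abs_of_pos h, abs_of_nonpos hb]; ring
  have hacD := belowDiam_of_pos φ pa pc
  have hcaD := belowDiam_of_pos φ pc pa
  set V : Fin 3 → ℝ := fun i => l * z.coord i + m * b.coord i with hVdef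
  have hsV : side a.coord c.coord V = 0 := by
    rw [← hV]; simp only [hVdef, side]; ring
  have hφV : 0 < φ V := by
    have e : V = l • z.coord + m • b.coord := rfl
    rw [e, map_add, map_smul, map_smul, smul_eq_mul, smul_eq_mul]
    rcases hl.eq_or_lt with rfl | hl
    · have : 0 < m := by linarith
      positivity
    · positivity
  obtain ⟨N, A, C, hN, hNV⟩ : ∃ N A C : ℝ, 0 < N ∧
      ∀ i, N * V i = A * a.coord i + C * c.coord i := by
    set x := a.coord
    set y := c.coord
    -- `w` is the cross product of `a` and `c`
    set w0 := x 1 * y 2 - x 2 * y 1 with h0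
    set w1 := x 2 * y 0 - x 0 * y 2 with h1
    set w2 := x 0 * y 1 - x 1 * y 0 with h2
    refine ⟨w0 ^ 2 + w1 ^ 2 + w2 ^ 2,
      V 0 * (y 1 * w2 - y 2 * w1) + V 1 * (y 2 * w0 - y 0 * w2) + V 2 * (y 0 * w1 - y 1 * w0),
      V 0 * (w1 * x 2 - w2 * x 1) + V 1 * (w2 * x 0 - w0 * x 2) + V 2 * (w0 * x 1 - w1 * x 0),
      ?_, ?_⟩
    · have hn := side_normal_pos hac hacD
      have hsg : Real.sign κ ≤ 1 := by
        rcases Real.sign_apply_eq κ with h | h | h <;> rw [h] <;> norm_num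
      have e : side a.coord c.coord (normal κ a.coord c.coord)
          = Real.sign κ * w0 ^ 2 + w1 ^ 2 + w2 ^ 2 := by
        simp only [side, normal, Matrix.cons_val]; ring
      rw [e] at hn
      nlinarith [mul_le_mul_of_nonneg_right hsg (sq_nonneg w0)]
    · have e : w0 * V 0 + w1 * V 1 + w2 * V 2 = 0 := hsV
      intro i
      fin_cases i
      · simp only [Fin.zero_eta]
        rw [h0, h1, h2] at e ⊢
        linear_combination (x 1 * y 2 - x 2 * y 1) * e
      · simp only [Fin.mk_one]
        rw [h0, h1, h2] at e ⊢
        linear_combination (x 2 * y 0 - x 0 * y 2) * e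
      · simp only [Fin.reduceFinMk]
        rw [h0, h1, h2] at e ⊢
        linear_combination (x 0 * y 1 - x 1 * y 0) * e
  have hφN : N * φ V = A * φ a.coord + C * φ c.coord := by
    have e : N • V = A • a.coord + C • c.coord := funext hNV
    have := congrArg φ e
    simpa only [map_add, map_smul, smul_eq_mul] using this
  have hφN0 := mul_pos hN hφV
  simp only [hVdef] at hNV
  rcases lt_or_ge A 0 with hA | hA
  · have hC : 0 < C := by
      by_contra! hC
      nlinarith [mul_nonneg (neg_pos.2 hA).le pa.le, mul_nonneg (neg_nonneg.2 hC) pc.le]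
    refine Or.inr (Or.inl (reflex_of_combo hac hD φ pa pb pc pz (l := N * l) (m := N * m)
      (r := -A) (s := C) (by positivity) (by positivity) (by rw [← mul_add]; positivity)
      (by linarith) hC fun i => ?_))
    linarith [hNV i]
  rcases lt_or_ge C 0 with hC | hC
  · have hA : 0 < A := by
      by_contra! hA
      nlinarith [mul_nonneg (neg_pos.2 hC).le pc.le, mul_nonneg (neg_nonneg.2 hA) pa.le]
    refine Or.inr (Or.inr (reflex_of_combo hac.symm (hD.mono ?_) φ pc pb pa pz (l := N * l)
      (m := N * m) (r := -C) (s := A) (by positivity) (by positivity)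
      (by rw [← mul_add]; positivity) (by linarith) hA fun i => ?_))
    · linarith [dist_comm c b, dist_comm b a, dist_comm a z, dist_comm z c]
    · linarith [hNV i]
  refine Or.inl ⟨A, C, N * m, N * l, hA, hC, by positivity, by positivity, ?_,
    by rw [← mul_add]; exact mul_pos hN (by linarith), fun i => by linarith [hNV i]⟩
  by_contra! h0
  have e1 : A = 0 := by linarith
  have e2 : C = 0 := by linarith
  rw [e1, e2] at hφN
  linarith

/-- A triangle with prescribed side lengths on a possibly degenerate side `[a, b]`. -/
theorem exists_triangle_of_le {a b : ModelPlane κ} {r s : ℝ} (hr : 0 ≤ r) (hs : 0 ≤ s)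
    (h1 : dist a b ≤ r + s) (h2 : r ≤ dist a b + s) (h3 : s ≤ dist a b + r)
    (hD : BelowDiam κ ((dist a b + r + s) / 2)) :
    ∃ z : ModelPlane κ, dist a z = r ∧ dist b z = s := by
  rcases eq_or_ne a b with rfl | hab
  · rw [dist_self] at *
    obtain ⟨z, hz⟩ := exists_dist_eq a hr (hD.mono (by linarith))
    exact ⟨z, hz, by linarith⟩
  · obtain ⟨z, hz, hz', -⟩ := exists_triangle hab hr hs h1 h2 h3 hD 0
    exact ⟨z, hz, hz'⟩

/-- A triangle `a c z` on the side `[a, c]` can be moved to the half plane selected by `ε` without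
changing the distances from its apex to the points of `[a, c]`. -/
theorem exists_congruent_triangle {a c z : ModelPlane κ} (hac : a ≠ c)
    (hD : BelowDiam κ ((dist a c + dist c z + dist z a) / 2)) (ε : ℝ) :
    ∃ y : ModelPlane κ, 0 ≤ ε * side a.coord c.coord y.coord ∧
      ∀ q, Btw a q c → dist q y = dist q z := by
  have hz := dist_comm z a
  have hDac : BelowDiam κ (dist a c) := hD.mono (by linarith [dist_triangle a z c, dist_comm c z])
  obtain ⟨y, h1, h2, h3⟩ := exists_triangle hac (dist_nonneg (x := a) (y := z))
    (dist_nonneg (x := c) (y := z)) (by linarith [dist_triangle a z c, dist_comm c z])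
    (dist_triangle a c z) (by linarith [dist_triangle c a z, dist_comm c a])
    (hD.mono (by linarith)) ε
  refine ⟨y, h3, fun q hq => ?_⟩
  rw [dist_comm q y, dist_comm q z]
  have e1 : dist y a = dist z a := by rw [dist_comm, h1, hz]
  have e2 : dist y c = dist z c := by rw [dist_comm, h2, dist_comm]
  exact le_antisymm (dist_le_of_sides_le hq hDac rfl rfl rfl e1.le e2.le)
    (dist_le_of_sides_le hq hDac rfl rfl rfl e1.ge e2.ge)

/-- **Alexandrov's lemma**: glue a triangle `a c z` to a triangle `a e c` along `[a, c]`. For a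
triangle with base `[a, e]` whose apex `z'` is at least as far from `a` as `z`, and from `e` as the
path `e c z` is long, the distance from `z'` to a point `p` of the base is at least the length of a
path from `p` to `z` in the glued figure. -/
theorem exists_path_le {a e c z z' p : ModelPlane κ}
    (hD : BelowDiam κ ((dist a e + dist e c + dist c z + dist z a) / 2)) (hp : Btw a p e)
    (h1 : dist a z ≤ dist a z') (h2 : dist e c + dist c z ≤ dist e z') :
    ∃ q, Btw a q c ∧ dist p q + dist q z ≤ dist p z' := by
  have hz := dist_comm z a
  have hsum : dist a p + dist p e = dist a e := hp
  have hae : BelowDiam κ (dist a e) :=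
    hD.mono (by linarith [dist_triangle4 a z c e, dist_comm c z, dist_comm e c])
  have hmono : ∀ x : ModelPlane κ, dist a x ≤ dist a z → dist e x ≤ dist e c + dist c z →
      dist p x ≤ dist p z' := by
    intro x ha he
    rw [dist_comm p x, dist_comm p z']
    exact dist_le_of_sides_le hp hae rfl rfl rfl (by rw [dist_comm x, dist_comm z']; linarith)
      (by rw [dist_comm x, dist_comm z']; linarith)
  rcases eq_or_ne a c with rfl | hac
  · obtain ⟨v, hv1, hv2⟩ := exists_extension (b := p) (c := a) (z := z)
      (hD.mono (by
        linarith [dist_comm a p, dist_comm e a, dist_nonneg (x := p) (y := e)]))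
    refine ⟨a, btw_left a a, ?_⟩
    rw [← hv1]
    exact hmono v hv2.le (by linarith [dist_triangle e a v])
  have hpc := dist_triangle p e c
  have hDz : BelowDiam κ ((dist a c + dist c z + dist z a) / 2) :=
    hD.mono (by linarith [dist_triangle a e c])
  obtain ⟨y, hside, hy⟩ := exists_congruent_triangle hac hDz (-side a.coord c.coord p.coord)
  have hya := hy a (btw_left a c)
  have hyc := hy c (btw_right a c)
  have hDy : BelowDiam κ ((dist a p + dist p c + dist c y + dist y a) / 2) :=
    hD.mono (by linarith [dist_comm y a])
  rcases meet_or_reflex hac hDy (by linarith) with h | ⟨v, hv1, hv2, hv3⟩ | ⟨v, hv1, hv2, hv3⟩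
  -- if `[p, y]` does not cross `[a, c]`, the path is prolonged straight on from `c` or `a` to a point
  -- `v` whose distances from `a` and `e` are not larger than those of `z'`
  · obtain ⟨q, hq1, hq2⟩ := h.exists_btw
      (hDz.mono (by linarith [dist_triangle a z c, dist_comm c z]))
      (hDy.mono (by
        linarith [dist_triangle p a y, dist_triangle p c y, dist_comm p a, dist_comm a y]))
    refine ⟨q, hq1, ?_⟩
    rw [← hy q hq1, show dist p q + dist q y = dist p y from hq2]
    exact hmono y hya.le (by linarith [dist_triangle e c y])
  · refine ⟨c, btw_right a c, ?_⟩
    rw [← hyc, ← hv1]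
    exact hmono v (by linarith) (by linarith [dist_triangle e c v])
  · refine ⟨a, btw_left a c, ?_⟩
    rw [← hya, ← hv1]
    exact hmono v (by linarith) (by linarith [dist_triangle e c v])

/-- In a convex quadrilateral `a b e c` (or if `b = e`), reflexity at `c` seen from `b` implies
reflexity at `c` seen from `e`. -/
theorem Reflex.of_meet {a b c e z : ModelPlane κ} (h : Reflex a c b z) (hm : Meet a e b c)
    (hD : BelowDiam κ ((dist a e + dist e c + dist c z + dist z a) / 2))
    (hbc : BelowDiam κ (dist b c)) : Reflex a c e z := by
  have hz := dist_comm z a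
  have hae : BelowDiam κ (dist a e) :=
    hD.mono (by linarith [dist_triangle4 a z c e, dist_comm c z, dist_comm e c])
  obtain ⟨r, hr1, hr2⟩ := hm.exists_btw hae hbc
  obtain ⟨v', hv1, hv2, hv3⟩ := h
  have s1 : dist a r + dist r e = dist a e := hr1
  have s2 : dist b r + dist r c = dist b c := hr2
  have hr : dist r c + dist c z ≤ dist r v' := by linarith [dist_triangle b r v']
  by_cases hre : r = e
  · subst hre
    exact ⟨v', le_antisymm (by linarith [dist_triangle r c v']) hr, hv2, hv3⟩
  have hlen : dist e c + dist c z ≤ dist a e + dist a z := by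
    linarith [dist_triangle e r c, dist_triangle r a v', dist_comm e r, dist_comm a r]
  obtain ⟨v, hw1, hw2⟩ := exists_extension (b := e) (c := c) (z := z)
    (hD.mono (by linarith))
  refine ⟨v, hw1, hw2, ?_⟩
  by_contra! hlt
  -- comparing `v` with `v'` on `[a, e]` makes `v` too far from `r` for the path via `c`
  have := dist_lt_of_side_lt hr1 hae hre (x := v') (y := v)
    (by rw [dist_comm v', dist_comm v]; linarith)
    (by rw [dist_comm v', dist_comm v]; linarith [dist_triangle e c v'])
  linarith [dist_triangle r c v, dist_comm v' r, dist_comm v r]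

/-! ### Convex polygons -/

/-- The sequence `x 0, …, x m` is a (possibly degenerate) convex polygon: for any four vertices in
cyclic order, the two diagonals of the quadrilateral that they form meet. -/
def ConvexSeq (x : ℕ → ModelPlane κ) (m : ℕ) : Prop :=
  ∀ ⦃i j k l⦄, i < j → j < k → k < l → l ≤ m → Meet (x i) (x k) (x j) (x l)

/-- The length of the polygonal path `x 0, …, x m`. -/
noncomputable def pathLength {M : Type*} [MetricSpace M] (x : ℕ → M) (m : ℕ) : ℝ :=
  ∑ i ∈ Finset.range m, dist (x i) (x (i + 1))

theorem dist_add_dist_le_pathLength {M : Type*} [MetricSpace M] (x : ℕ → M) {i j m : ℕ}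
    (hij : i ≤ j) (hjm : j ≤ m) :
    dist (x 0) (x i) + dist (x i) (x j) + dist (x j) (x m) ≤ pathLength x m := by
  have h1 := dist_le_Ico_sum_dist x (Nat.zero_le i)
  have h2 := dist_le_Ico_sum_dist x hij
  have h3 := dist_le_Ico_sum_dist x hjm
  have e1 := Finset.sum_Ico_consecutive (fun i => dist (x i) (x (i + 1))) (Nat.zero_le i) hij
  have e2 := Finset.sum_Ico_consecutive (fun i => dist (x i) (x (i + 1))) (Nat.zero_le j) hjm
  rw [pathLength, Finset.range_eq_Ico]
  linarith

theorem pathLength_reverse {M : Type*} [MetricSpace M] (x : ℕ → M) (m : ℕ) :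
    pathLength (fun i => x (m - i)) m = pathLength x m := by
  unfold pathLength
  rw [← Finset.sum_range_reflect]
  refine Finset.sum_congr rfl fun i hi => ?_
  have hi := Finset.mem_range.1 hi
  beta_reduce
  rw [dist_comm, show m - (m - 1 - i + 1) = i by omega, show m - (m - 1 - i) = i + 1 by omega]

theorem ConvexSeq.reverse {x : ℕ → ModelPlane κ} {m : ℕ} (h : ConvexSeq x m) :
    ConvexSeq (fun i => x (m - i)) m := fun i j k l hij hjk hkl hl =>
  (h (i := m - l) (j := m - k) (k := m - j) (l := m - i) (by omega) (by omega) (by omega)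
    (by omega)).comm.swap_left.swap_right

theorem Meet.side_mul_side_nonneg {a c p q : ModelPlane κ} (h : Meet a p q c) (hac : a ≠ c) :
    0 ≤ side a.coord c.coord p.coord * side a.coord c.coord q.coord := by
  obtain ⟨s, t, u, v, hs, ht, hu, hv, hst, huv, h⟩ := h
  by_contra! hneg
  have e : t * side a.coord c.coord p.coord = u * side a.coord c.coord q.coord := by
    simp only [side]
    linear_combination (a.coord 1 * c.coord 2 - a.coord 2 * c.coord 1) * h 0 +
      (a.coord 2 * c.coord 0 - a.coord 0 * c.coord 2) * h 1 +
      (a.coord 0 * c.coord 1 - a.coord 1 * c.coord 0) * h 2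
  have hp : side a.coord c.coord p.coord ≠ 0 := fun h0 => by simp [h0] at hneg
  have hq : side a.coord c.coord q.coord ≠ 0 := fun h0 => by simp [h0] at hneg
  have ht0 : t * side a.coord c.coord p.coord ^ 2 = 0 := by
    apply le_antisymm _ (by positivity)
    rw [sq, ← mul_assoc, e, mul_assoc, mul_comm (side a.coord c.coord q.coord)]
    exact mul_nonpos_of_nonneg_of_nonpos hu hneg.le
  have ht' : t = 0 := by simpa [hp] using ht0
  have hu' : u = 0 := by simpa [ht', hq] using e
  subst ht' hu'
  exact hac (eq_of_smul_coord_eq (c := s) (d := v) (by linarith) (by linarith)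
    fun i => by linarith [h i])

/-- A convex polygon lies on one side of the line through its first and its last vertex. -/
theorem ConvexSeq.exists_side {x : ℕ → ModelPlane κ} {m : ℕ} (h : ConvexSeq x m)
    (hne : x 0 ≠ x m) : ∃ ε : ℝ, ε ^ 2 = 1 ∧
      ∀ j ≤ m, 0 ≤ ε * side (x 0).coord (x m).coord (x j).coord := by
  have h0 : side (x 0).coord (x m).coord (x 0).coord = 0 := by unfold side; ring
  have hm : side (x 0).coord (x m).coord (x m).coord = 0 := by unfold side; ring
  have hprod : ∀ i j, i < j → j ≤ m → 0 ≤ side (x 0).coord (x m).coord (x j).coord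
      * side (x 0).coord (x m).coord (x i).coord := by
    intro i j hij hj
    rcases Nat.eq_zero_or_pos i with rfl | hi
    · simp [h0]
    rcases hj.eq_or_lt with rfl | hj
    · simp [hm]
    exact (h hi hij hj le_rfl).side_mul_side_nonneg hne
  by_cases hall : ∀ j ≤ m, 0 ≤ side (x 0).coord (x m).coord (x j).coord
  · exact ⟨1, by norm_num, by simpa using hall⟩
  · push Not at hall
    obtain ⟨i, hi, hneg⟩ := hall
    refine ⟨-1, by norm_num, fun j hj => ?_⟩
    rcases lt_trichotomy i j with hij | rfl | hij
    · have := hprod i j hij hj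
      by_contra! hc
      nlinarith
    · linarith
    · have := hprod j i hij hi
      by_contra! hc
      nlinarith

/-! ### Adding a vertex to a convex polygon -/

/-- The points `y 0, …, y m, w` form a convex polygon which results from the polygon
`x 0, …, x m` by adding a vertex: the sides of `x` are kept, its diagonals are not shortened, the new
sides have lengths `r` and `s`, and the distance of `w` to `y j` is at least `t j`. -/
structure IsExtension (x : ℕ → ModelPlane κ) (m : ℕ) (r s : ℝ) (t : ℕ → ℝ)
    (y : ℕ → ModelPlane κ) (w : ModelPlane κ) : Prop where
  convex : ConvexSeq y m
  convex_apex : ∀ ⦃i j k⦄, i < j → j < k → k ≤ m → Meet w (y j) (y i) (y k)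
  dist_succ : ∀ i < m, dist (y i) (y (i + 1)) = dist (x i) (x (i + 1))
  le_dist : ∀ i ≤ m, ∀ j ≤ m, dist (x i) (x j) ≤ dist (y i) (y j)
  dist_first : dist (y 0) w = r
  dist_last : dist (y m) w = s
  le_dist_apex : ∀ j ≤ m, t j ≤ dist (y j) w

theorem IsExtension.reverse {x : ℕ → ModelPlane κ} {m : ℕ} {r s : ℝ} {t : ℕ → ℝ}
    {y : ℕ → ModelPlane κ} {w : ModelPlane κ}
    (h : IsExtension (fun i => x (m - i)) m s r (fun i => t (m - i)) y w) :
    IsExtension x m r s t (fun i => y (m - i)) w where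
  convex := h.convex.reverse
  convex_apex i j k hij hjk hk :=
    (h.convex_apex (i := m - k) (j := m - j) (k := m - i) (by omega) (by omega)
      (by omega)).swap_right
  dist_succ i hi := by
    have := h.dist_succ (m - (i + 1)) (by omega)
    rw [show m - (i + 1) + 1 = m - i by omega, show m - (m - (i + 1)) = i + 1 by omega,
      show m - (m - i) = i by omega] at this
    rw [dist_comm, this, dist_comm]
  le_dist i hi j hj := by
    have := h.le_dist (m - i) (by omega) (m - j) (by omega)
    rwa [show m - (m - i) = i by omega, show m - (m - j) = j by omega] at this
  dist_first := by simpa using h.dist_last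
  dist_last := by simpa using h.dist_first
  le_dist_apex j hj := by
    have := h.le_dist_apex (m - j) (by omega)
    rwa [show m - (m - j) = j by omega] at this

/-- Each triangle with base `[x 0, x m]` and apex `z`, glued to the convex polygon `x 0, …, x m`,
can be straightened to a convex polygon. The lower bounds `t j` for the distances to the apex have to
be lower bounds for the lengths of the paths from `x j` to `z` in the glued figure. -/
def HasExtensions (κ : ℝ) (m : ℕ) : Prop :=
  ∀ (x : ℕ → ModelPlane κ) (z : ModelPlane κ) (t : ℕ → ℝ), ConvexSeq x m →
    BelowDiam κ ((pathLength x m + dist (x m) z + dist z (x 0)) / 2) →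
    (∀ j ≤ m, ∀ q, Btw (x 0) q (x m) → t j ≤ dist (x j) q + dist q z) →
    ∃ y w, IsExtension x m (dist (x 0) z) (dist (x m) z) t y w

/-- If the segments from `z` to the vertices cross the base, the glued figure is convex. -/
theorem isExtension_of_meet {x : ℕ → ModelPlane κ} {m : ℕ} {z : ModelPlane κ} {t : ℕ → ℝ}
    (hx : ConvexSeq x m)
    (hD : BelowDiam κ ((pathLength x m + dist (x m) z + dist z (x 0)) / 2))
    (ht : ∀ j ≤ m, ∀ q, Btw (x 0) q (x m) → t j ≤ dist (x j) q + dist q z)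
    (hmeet : ∀ j, 0 < j → j < m → Meet (x 0) (x m) (x j) z) :
    IsExtension x m (dist (x 0) z) (dist (x m) z) t x z := by
  have hz := dist_comm z (x 0)
  have hbase : BelowDiam κ (dist (x 0) (x m)) := hD.mono (by
    have := dist_add_dist_le_pathLength x (le_refl 0) (Nat.zero_le m)
    rw [dist_self] at this
    linarith [dist_triangle (x 0) z (x m), dist_comm z (x m)])
  refine ⟨hx, fun i j k hij hjk hk => ?_, fun _ _ => rfl, fun _ _ _ _ => le_rfl, rfl, rfl,
    fun j hj => ?_⟩
  · obtain ⟨s, t, u, v, hs, ht, hu, hv, hst, huv, h⟩ := hmeet j (by omega) (by omega)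
    obtain ⟨p, c, hc, -, hp⟩ := exists_point_of_combo hbase hs ht hst
    have m0 : Meet (x 0) (x j) (x i) (x k) := by
      rcases Nat.eq_zero_or_pos i with rfl | hi
      · exact meet_of_left_eq _ _ _
      · exact hx hi hij hjk hk
    have mm : Meet (x m) (x j) (x i) (x k) := by
      rcases hk.eq_or_lt with rfl | hk
      · exact (meet_of_left_eq _ _ _).swap_right
      · exact (hx hij hjk hk le_rfl).comm.swap_left
    obtain ⟨s', t', u', v', hs', ht', hu', hv', hst', huv', h'⟩ :=
      m0.of_combo mm hs ht hst hc fun n => (hp n).symm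
    refine ⟨s' * v / c, s' * u / c + t', u', v', by positivity, by positivity, hu', hv', ?_, huv',
      fun n => ?_⟩
    · have e : s' * v / c + (s' * u / c + t') = s' * (u + v) / c + t' := by ring
      rw [e]
      rcases hs'.eq_or_lt with rfl | hs'
      · simpa using hst'
      · positivity
    · rw [← h' n]
      have := (hp n).symm.trans (h n)
      have e : p.coord n = (u * (x j).coord n + v * z.coord n) / c := by
        rw [eq_div_iff hc.ne']; linarith
      rw [e]; ring
  · rcases Nat.eq_zero_or_pos j with rfl | hj0
    · simpa using ht 0 hj (x 0) (btw_left _ _)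
    rcases hj.eq_or_lt with rfl | hjm
    · simpa using ht j hj (x j) (btw_right _ _)
    have := dist_add_dist_le_pathLength x (Nat.zero_le j) hj
    rw [dist_self] at this
    obtain ⟨q, hq1, hq2⟩ := (hmeet j hj0 hjm).exists_btw hbase (hD.mono (by
      linarith [dist_triangle (x j) (x 0) z, dist_triangle (x j) (x m) z,
        dist_comm (x j) (x 0)]))
    exact (ht j hj q hq1).trans hq2.le

/-- If the glued figure is reflex at the last vertex, the last vertex is first removed and the two
sides meeting there are straightened. The polygon is extended by induction, and the vertex is put
back on the straightened side. -/
theorem exists_isExtension_of_reflex {m : ℕ} (ih : HasExtensions κ m) {x : ℕ → ModelPlane κ}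
    {z : ModelPlane κ} {t : ℕ → ℝ} (hx : ConvexSeq x (m + 1))
    (hD : BelowDiam κ ((pathLength x (m + 1) + dist (x (m + 1)) z + dist z (x 0)) / 2))
    (ht : ∀ j ≤ m + 1, ∀ q, Btw (x 0) q (x (m + 1)) → t j ≤ dist (x j) q + dist q z)
    {j : ℕ} (hj0 : 0 < j) (hjm : j ≤ m) (hj : Reflex (x 0) (x (m + 1)) (x j) z) :
    ∃ y w, IsExtension x (m + 1) (dist (x 0) z) (dist (x (m + 1)) z) t y w := by
  have hlen : pathLength x (m + 1) = pathLength x m + dist (x m) (x (m + 1)) :=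
    Finset.sum_range_succ _ _
  have hz := dist_comm z (x 0)
  have hpl := dist_add_dist_le_pathLength x (Nat.zero_le m) le_rfl
  rw [dist_self, dist_self] at hpl
  have hD4 : BelowDiam κ ((dist (x 0) (x m) + dist (x m) (x (m + 1)) + dist (x (m + 1)) z
      + dist z (x 0)) / 2) := hD.mono (by linarith)
  have hlast : Reflex (x 0) (x (m + 1)) (x m) z := by
    rcases hjm.eq_or_lt with rfl | hjm'
    · exact hj
    · refine hj.of_meet (hx hj0 hjm' (Nat.lt_succ_self m) le_rfl) hD4 (hD.mono ?_)
      have := dist_add_dist_le_pathLength x (show j ≤ m + 1 by omega) le_rfl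
      rw [dist_self] at this
      linarith [dist_triangle4 (x j) (x 0) z (x (m + 1)), dist_comm (x j) (x 0),
        dist_comm z (x (m + 1))]
  obtain ⟨v, hv1, hv2, hv3⟩ := hlast
  have n1 := dist_nonneg (x := x m) (y := x (m + 1))
  have n2 := dist_nonneg (x := x (m + 1)) (y := z)
  have hlt : dist (x m) v ≤ dist (x 0) (x m) + dist (x 0) z := by
    linarith [dist_triangle (x m) (x 0) v, dist_comm (x m) (x 0)]
  have hDv : BelowDiam κ (dist (x m) v) := hD4.mono (by linarith)
  have hDm : BelowDiam κ (dist (x 0) (x m)) := hD4.mono (by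
    linarith [dist_triangle4 (x 0) z (x (m + 1)) (x m), dist_comm z (x (m + 1)),
      dist_comm (x m) (x (m + 1))])
  obtain ⟨z', hz1, hz2⟩ := exists_triangle_of_le (a := x 0) (b := x m) (r := dist (x 0) z)
    (s := dist (x m) v) dist_nonneg dist_nonneg
    (by linarith [dist_triangle4 (x 0) z (x (m + 1)) (x m), dist_comm z (x (m + 1)),
      dist_comm (x m) (x (m + 1))])
    (by linarith [dist_triangle4 (x 0) (x m) (x (m + 1)) z]) hlt (hD4.mono (by linarith))
  -- `z'` is the apex over the new base `[x 0, x m]`, and `v` is not farther from this base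
  have hpv : ∀ p, Btw (x 0) p (x m) → dist p v ≤ dist p z' := by
    intro p hp
    rw [dist_comm p v, dist_comm p z']
    exact dist_le_of_sides_le hp hDm rfl rfl rfl
      (by rw [dist_comm v, dist_comm z', hz1]; exact hv3)
      (by rw [dist_comm v, dist_comm z', hz2])
  obtain ⟨y, w, hy⟩ := ih x z' (fun j => max (t j) (dist (x j) v))
    (fun i j k l hij hjk hkl hl => hx hij hjk hkl (by omega))
    (hD.mono (by rw [hz2, dist_comm z' (x 0), hz1, hv1]; linarith))
    (by
      intro j hj p hp
      apply max_le
      · obtain ⟨q, hq1, hq2⟩ := exists_path_le hD4 hp hz1.ge (by rw [hz2, hv1])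
        linarith [ht j (by omega) q hq1, dist_triangle (x j) p q]
      · linarith [hpv p hp, dist_triangle (x j) p v])
  have hyw : dist (y m) w = dist (x m) v := by rw [hy.dist_last, hz2]
  have hDw : BelowDiam κ (dist (y m) w) := by rwa [hyw]
  have hxv : Btw (x m) (x (m + 1)) v := by unfold Btw; rw [hv1, hv2]
  -- `c` takes the place of the removed vertex `x (m + 1)`
  obtain ⟨c, hc1, hc2⟩ := exists_btw_of_add_eq (a := y m) (b := w) n1 n2
    (by rw [hyw, hv1]) hDw
  have hc : Btw (y m) c w := by unfold Btw; rw [hc1, hc2, hyw, hv1]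
  have hdist : ∀ j ≤ m, dist (x j) (x (m + 1)) ≤ dist (y j) c := by
    intro j hj
    exact dist_le_of_sides_le hxv hDv hc1 (by rw [hc2, hv2]) hyw (hy.le_dist j hj m le_rfl)
      ((le_max_right _ _).trans (hy.le_dist_apex j hj))
  have hYle : ∀ i ≤ m, Function.update y (m + 1) c i = y i := fun i hi =>
    Function.update_of_ne (by omega) _ _
  have hYm : Function.update y (m + 1) c (m + 1) = c := Function.update_self _ _ _
  refine ⟨Function.update y (m + 1) c, w, ⟨?_, ?_, ?_, ?_, ?_, ?_, ?_⟩⟩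
  · intro i j k l hij hjk hkl hl
    rw [hYle i (by omega), hYle j (by omega), hYle k (by omega)]
    rcases Nat.le_or_eq_of_le_succ hl with hl | rfl
    · rw [hYle l hl]
      exact hy.convex hij hjk hkl hl
    · rw [hYm]
      have m1 : Meet (y m) (y j) (y i) (y k) := by
        rcases (Nat.le_of_lt_succ hkl).eq_or_lt with rfl | hk
        · exact (meet_of_left_eq _ _ _).swap_right
        · exact (hy.convex hij hjk hk le_rfl).comm.swap_left
      have m2 : Meet w (y j) (y i) (y k) := hy.convex_apex hij hjk (by omega)
      exact (m1.of_btw m2 hc hDw).swap_left.comm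
  · intro i j k hij hjk hk
    rw [hYle i (by omega), hYle j (by omega)]
    rcases Nat.le_or_eq_of_le_succ hk with hk | rfl
    · rw [hYle k hk]
      exact hy.convex_apex hij hjk hk
    · rw [hYm]
      have m1 : Meet (y m) (y i) w (y j) := by
        rcases (Nat.le_of_lt_succ hjk).eq_or_lt with rfl | hj
        · exact (meet_of_left_eq _ _ _).swap_right
        · exact (hy.convex_apex hij hj le_rfl).comm.swap_left
      exact (m1.of_btw (meet_of_left_eq w (y i) (y j)) hc hDw).comm.swap_right
  · intro i hi
    rcases Nat.le_or_eq_of_le_succ (show i + 1 ≤ m + 1 by omega) with hi' | hi'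
    · rw [hYle i (by omega), hYle _ hi', hy.dist_succ i hi']
    · obtain rfl : i = m := by omega
      rw [hYle i le_rfl, hYm, hc1]
  · intro i hi j hj
    rcases Nat.le_or_eq_of_le_succ hi with hi | rfl <;>
      rcases Nat.le_or_eq_of_le_succ hj with hj | rfl
    · rw [hYle i hi, hYle j hj]
      exact hy.le_dist i hi j hj
    · rw [hYle i hi, hYm]
      exact hdist i hi
    · rw [hYle j hj, hYm, dist_comm, dist_comm c]
      exact hdist j hj
    · simp
  · rw [hYle 0 (by omega), hy.dist_first, hz1]
  · rw [hYm, hc2]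
  · intro j hj
    rcases Nat.le_or_eq_of_le_succ hj with hj | rfl
    · rw [hYle j hj]
      exact (le_max_left _ _).trans (hy.le_dist_apex j hj)
    · rw [hYm, hc2]
      simpa using ht (m + 1) le_rfl (x (m + 1)) (btw_right _ _)

/-- A vertex can be added to a convex polygon with any number of vertices. Where the glued figure
fails to be convex, it is reflex at an end of the base, and the number of vertices is reduced. -/
theorem hasExtensions (κ : ℝ) {m : ℕ} (hm : 1 ≤ m) : HasExtensions κ m := by
  induction m, hm using Nat.le_induction with
  | base =>
    intro x z t hx hD ht
    exact ⟨x, z, isExtension_of_meet hx hD ht fun j _ _ => by omega⟩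
  | succ m hm ih =>
    intro x z t hx hD ht
    have hz := dist_comm z (x 0)
    by_cases hne : x 0 = x (m + 1)
    · -- the base is a point, and both sides that end there are to be straightened
      have hpl := dist_add_dist_le_pathLength x (show m ≤ m + 1 by omega) le_rfl
      rw [dist_self] at hpl
      obtain ⟨v, hv1, hv2⟩ := exists_extension (b := x m) (c := x (m + 1)) (z := z)
        (hD.mono (by rw [hne] at hpl hz ⊢; linarith [dist_comm (x m) (x (m + 1))]))
      exact exists_isExtension_of_reflex ih hx hD ht hm le_rfl ⟨v, hv1, hv2, by rw [hne, hv2]⟩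
    obtain ⟨ε, hε, hside⟩ := hx.exists_side hne
    have hpl := dist_add_dist_le_pathLength x (Nat.zero_le (m + 1)) le_rfl
    rw [dist_self, dist_self] at hpl
    obtain ⟨y, hy1, hy2⟩ := exists_congruent_triangle (z := z) hne (hD.mono (by linarith)) (-ε)
    have e0 := hy2 _ (btw_left _ _)
    have em := hy2 _ (btw_right _ _)
    have hy := dist_comm y (x 0)
    have hDy : BelowDiam κ ((pathLength x (m + 1) + dist (x (m + 1)) y + dist y (x 0)) / 2) := by
      rwa [em, dist_comm y, e0, dist_comm (x 0)]
    have hty : ∀ j ≤ m + 1, ∀ q, Btw (x 0) q (x (m + 1)) → t j ≤ dist (x j) q + dist q y :=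
      fun j hj q hq => by rw [hy2 q hq]; exact ht j hj q hq
    rw [← e0, ← em]
    by_cases hall : ∀ j, 0 < j → j < m + 1 → Meet (x 0) (x (m + 1)) (x j) y
    · exact ⟨x, y, isExtension_of_meet hx hDy hty hall⟩
    push Not at hall
    obtain ⟨j, hj0, hjm, hj⟩ := hall
    have hplj := dist_add_dist_le_pathLength x (Nat.zero_le j) hjm.le
    rw [dist_self] at hplj
    have hopp : side (x 0).coord (x (m + 1)).coord (x j).coord
        * side (x 0).coord (x (m + 1)).coord y.coord ≤ 0 := by
      have h1 := mul_nonneg (hside j hjm.le) hy1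
      have e : ε * side (x 0).coord (x (m + 1)).coord (x j).coord
          * (-ε * side (x 0).coord (x (m + 1)).coord y.coord)
          = -ε ^ 2 * (side (x 0).coord (x (m + 1)).coord (x j).coord
          * side (x 0).coord (x (m + 1)).coord y.coord) := by ring
      rw [e, hε] at h1
      linarith
    rcases meet_or_reflex hne (hDy.mono (by linarith)) hopp with h | h | h
    · exact absurd h hj
    · exact exists_isExtension_of_reflex ih hx hDy hty hj0 (by omega) h
    · -- the polygon is traversed in the opposite direction
      obtain ⟨y', w, hyw⟩ := exists_isExtension_of_reflex (x := fun i => x (m + 1 - i)) (z := y)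
        (t := fun i => t (m + 1 - i)) ih hx.reverse (by
          rw [pathLength_reverse]
          simp only [Nat.sub_self, Nat.sub_zero]
          rwa [dist_comm (x 0), dist_comm y (x (m + 1)), add_right_comm]) (by
          intro i _ q hq
          simp only [Nat.sub_self, Nat.sub_zero] at hq
          exact hty _ (by omega) q hq.symm) (j := m + 1 - j) (by omega) (by omega) (by
          simp only [Nat.sub_self, Nat.sub_zero, show m + 1 - (m + 1 - j) = j by omega]
          exact h)
      simp only [Nat.sub_self, Nat.sub_zero] at hyw
      exact ⟨_, w, hyw.reverse⟩

/-! ### Polygons in `Cycl₄(κ)` spaces -/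

theorem coe_lt_two_mul_modelDiam_iff {r : ℝ} :
    (r : EReal) < 2 * modelDiam κ ↔ BelowDiam κ (r / 2) := by
  unfold modelDiam BelowDiam
  split_ifs with hk
  · have hp := Real.sqrt_pos.2 hk
    have e : (2 : EReal) * ((Real.pi / √κ : ℝ) : EReal) = ((2 * (Real.pi / √κ) : ℝ) : EReal) := by
      rw [EReal.coe_mul]; rfl
    rw [e, EReal.coe_lt_coe_iff, ← mul_div_assoc, lt_div_iff₀ hp]
    constructor
    · intro h _; linarith
    · intro h; linarith [h hk]
  · rw [EReal.mul_top_of_pos (by norm_num)]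
    exact ⟨fun _ h => absurd h hk, fun _ => EReal.coe_lt_top r⟩

theorem _root_.IsCycl.exists_quadrilateral {X : Type*} [MetricSpace X] (hX : IsCycl 4 κ X)
    (p q r s : X) (hD : BelowDiam κ ((dist p q + dist q r + dist r s + dist s p) / 2)) :
    ∃ a b c d : ModelPlane κ, dist a b ≤ dist p q ∧ dist b c ≤ dist q r ∧ dist c d ≤ dist r s ∧
      dist d a ≤ dist s p ∧ dist p r ≤ dist a c ∧ dist q s ≤ dist b d := by
  let f : ZMod 4 → X := ![p, q, r, s]
  have hf : cyclicPerimeter f = dist p q + dist q r + dist r s + dist s p := Fin.sum_univ_four _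
  obtain ⟨g, h1, h2⟩ := hX f (by rw [hf]; exact coe_lt_two_mul_modelDiam_iff.2 hD)
  exact ⟨g 0, g 1, g 2, g 3, h1 0, h1 1, h1 2, h1 3, h2 0 2 (by decide) (by decide),
    h2 1 3 (by decide) (by decide)⟩

/-- The comparison polygon of a sequence of points, built by adding one vertex at a time to a
segment. -/
theorem _root_.IsCycl.exists_convexSeq {X : Type*} [MetricSpace X] (hX : IsCycl 4 κ X)
    {m : ℕ} (hm : 1 ≤ m) (f : ℕ → X)
    (hD : BelowDiam κ ((pathLength f m + dist (f m) (f 0)) / 2)) :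
    ∃ g : ℕ → ModelPlane κ, ConvexSeq g m ∧
      (∀ i < m, dist (g i) (g (i + 1)) = dist (f i) (f (i + 1))) ∧
      dist (g m) (g 0) = dist (f m) (f 0) ∧
      ∀ i ≤ m, ∀ j ≤ m, dist (f i) (f j) ≤ dist (g i) (g j) := by
  induction m, hm using Nat.le_induction with
  | base =>
    obtain ⟨b, -, -⟩ := exists_pair κ
    obtain ⟨z, hz⟩ := exists_dist_eq b (dist_nonneg (x := f 0) (y := f 1)) (hD.mono (by
      simp only [pathLength, Finset.sum_range_one, dist_comm (f 1)]; linarith))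
    refine ⟨fun i => if i = 0 then b else z, fun i j k l _ _ _ _ => by omega, fun i hi => ?_, ?_,
      fun i hi j hj => ?_⟩
    · obtain rfl : i = 0 := by omega
      simpa using hz
    · simp [dist_comm, hz]
    · interval_cases i <;> interval_cases j <;> simp [hz, dist_comm z b, dist_comm (f 1)]
  | succ m hm ih =>
    have hlen : pathLength f (m + 1) = pathLength f m + dist (f m) (f (m + 1)) :=
      Finset.sum_range_succ _ _
    have htri := dist_triangle (f m) (f (m + 1)) (f 0)
    obtain ⟨x, hx1, hx2, hx3, hx4⟩ := ih (hD.mono (by linarith))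
    have hxlen : pathLength x m = pathLength f m :=
      Finset.sum_congr rfl fun i hi => hx2 i (Finset.mem_range.1 hi)
    have hbase : dist (x 0) (x m) = dist (f 0) (f m) := by rw [dist_comm, hx3, dist_comm]
    have hpl := dist_add_dist_le_pathLength f (Nat.zero_le m) le_rfl
    rw [dist_self, dist_self] at hpl
    obtain ⟨z, hz1, hz2⟩ := exists_triangle_of_le (a := x 0) (b := x m)
      (r := dist (f 0) (f (m + 1))) (s := dist (f m) (f (m + 1))) dist_nonneg dist_nonneg
      (by rw [hbase]; exact (dist_triangle_right _ _ _))
      (by rw [hbase]; exact dist_triangle _ _ _)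
      (by rw [hbase, dist_comm (f 0) (f m)]; exact dist_triangle _ _ _)
      (hD.mono (by rw [hbase]; linarith [dist_comm (f 0) (f (m + 1))]))
    have hbaseD : BelowDiam κ (dist (x 0) (x m)) := hD.mono (by
      rw [hbase]; linarith [dist_comm (f 0) (f m)])
    obtain ⟨y, w, hy⟩ := hasExtensions κ hm x z (fun j => dist (f j) (f (m + 1))) hx1
      (hD.mono (by rw [hxlen, hz2, dist_comm z, hz1, dist_comm (f 0)]; linarith)) (by
        intro j hj q hq
        have hplj := dist_add_dist_le_pathLength f (Nat.zero_le j) hj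
        rw [dist_self] at hplj
        obtain ⟨a, b, c, d, hab, hbc, hcd, hda, hac, hbd⟩ :=
          hX.exists_quadrilateral (f 0) (f j) (f m) (f (m + 1)) (hD.mono (by linarith))
        refine hbd.trans (dist_le_add_of_diagonal hq hbaseD (hbase.trans_le hac) ?_ ?_ ?_ ?_)
        · rw [dist_comm]
          exact hab.trans ((hx4 0 (Nat.zero_le _) j hj).trans_eq (dist_comm _ _))
        · exact hbc.trans (hx4 j hj m le_rfl)
        · rw [dist_comm z, hz1, dist_comm (f 0)]
          exact hda
        · rw [dist_comm z, hz2, dist_comm d]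
          exact hcd)
    rw [hz1, hz2] at hy
    have hYle : ∀ i ≤ m, Function.update y (m + 1) w i = y i := fun i hi =>
      Function.update_of_ne (by omega) _ _
    have hYm : Function.update y (m + 1) w (m + 1) = w := Function.update_self _ _ _
    refine ⟨Function.update y (m + 1) w, ?_, ?_, ?_, ?_⟩
    · intro i j k l hij hjk hkl hl
      rw [hYle i (by omega), hYle j (by omega), hYle k (by omega)]
      rcases Nat.le_or_eq_of_le_succ hl with hl | rfl
      · rw [hYle l hl]
        exact hy.convex hij hjk hkl hl
      · rw [hYm]
        exact (hy.convex_apex hij hjk (by omega)).comm.swap_right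
    · intro i hi
      rcases Nat.le_or_eq_of_le_succ (show i + 1 ≤ m + 1 by omega) with hi' | hi'
      · rw [hYle i (by omega), hYle _ hi', hy.dist_succ i hi', hx2 i hi']
      · obtain rfl : i = m := by omega
        rw [hYle i le_rfl, hYm, hy.dist_last]
    · rw [hYm, hYle 0 (by omega), dist_comm, hy.dist_first, dist_comm]
    · intro i hi j hj
      rcases Nat.le_or_eq_of_le_succ hi with hi | rfl <;>
        rcases Nat.le_or_eq_of_le_succ hj with hj | rfl
      · rw [hYle i hi, hYle j hj]
        exact (hx4 i hi j hj).trans (hy.le_dist i hi j hj)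
      · rw [hYle i hi, hYm]
        exact hy.le_dist_apex i hi
      · rw [hYle j hj, hYm, dist_comm, dist_comm w]
        exact hy.le_dist_apex j hj
      · simp

/-- The segment from a vertex of a convex polygon to any other vertex meets the diagonal between its
two neighbours `p` and `s`. -/
theorem ConvexSeq.meet_neighbours {g : ℕ → ModelPlane κ} {m : ℕ} (h : ConvexSeq g m)
    {a b p s : ℕ} (ha : a ≤ m) (hb : b ≤ m) (hab : a ≠ b)
    (hp : a = 0 ∧ p = m ∨ a = p + 1) (hs : a = m ∧ s = 0 ∨ s = a + 1 ∧ s ≤ m) :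
    Meet (g a) (g b) (g p) (g s) := by
  by_cases hbp : b = p
  · subst hbp
    exact (meet_of_left_eq _ _ _).swap_left
  by_cases hbs : b = s
  · subst hbs
    exact (meet_of_left_eq _ _ _).swap_left.swap_right
  rcases hp with ⟨rfl, rfl⟩ | rfl
  · obtain rfl : s = 1 := by omega
    exact (h (by omega) (by omega) (by omega) le_rfl : Meet (g 0) (g b) (g 1) (g p)).swap_right
  rcases hs with ⟨rfl, rfl⟩ | ⟨rfl, hs⟩
  · exact (h (by omega) (by omega) (by omega) le_rfl :
      Meet (g 0) (g p) (g b) (g (p + 1))).comm.swap_left.swap_right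
  rcases lt_or_gt_of_ne hab with hlt | hlt
  · exact (h (by omega) (by omega) (by omega) hb :
      Meet (g p) (g (p + 1 + 1)) (g (p + 1)) (g b)).comm
  · exact (h (by omega) (by omega) (by omega) hs :
      Meet (g b) (g (p + 1)) (g p) (g (p + 1 + 1))).swap_left

theorem cyclicPerimeter_eq {X : Type*} [MetricSpace X] {m : ℕ} (f : ZMod (m + 1) → X) :
    cyclicPerimeter f = pathLength (fun i : ℕ => f i) m + dist (f (m : ℕ)) (f (0 : ℕ)) := by
  have h1 : cyclicPerimeter f
      = ∑ i ∈ Finset.range (m + 1), dist (f (i : ℕ)) (f ((i : ℕ) + 1)) := by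
    refine Finset.sum_nbij' (fun i => i.val) (fun i => (i : ZMod (m + 1))) ?_ ?_ ?_ ?_ ?_
    · exact fun i _ => Finset.mem_range.2 i.val_lt
    · exact fun i _ => Finset.mem_univ _
    · exact fun i _ => ZMod.natCast_zmod_val i
    · exact fun i hi => ZMod.val_cast_of_lt (Finset.mem_range.1 hi)
    · intro i _
      rw [ZMod.natCast_zmod_val]
  have h2 : (m : ZMod (m + 1)) + 1 = (0 : ℕ) := by
    have := ZMod.natCast_self (m + 1)
    push_cast at this ⊢
    exact this
  rw [h1, Finset.sum_range_succ, h2, pathLength]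
  push_cast
  rfl

theorem _root_.IsCycl.exists_convex_polygon {X : Type*} [MetricSpace X] (hX : IsCycl 4 κ X)
    {m : ℕ} (hm : 1 ≤ m) (f : ZMod (m + 1) → X)
    (hperim : (cyclicPerimeter f : EReal) < 2 * modelDiam κ) :
    ∃ g : ZMod (m + 1) → ModelPlane κ,
      (∀ i j, dist (g i) (g (i + 1)) = dist (f i) (f (i + 1)) ∧
        dist (f i) (f j) ≤ dist (g i) (g j)) ∧
      (∀ i j, i ≠ j →
        (geodesicSegment (g i) (g j) ∩ geodesicSegment (g (i - 1)) (g (i + 1))).Nonempty) := by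
  rw [coe_lt_two_mul_modelDiam_iff, cyclicPerimeter_eq] at hperim
  obtain ⟨g, hconv, hsucc, hclose, hle⟩ := hX.exists_convexSeq hm (fun i : ℕ => f i) hperim
  have hval : ∀ i : ZMod (m + 1), i.val ≤ m := fun i => Nat.le_of_lt_succ i.val_lt
  have hadd : ∀ i : ZMod (m + 1), i.val = m ∧ (i + 1).val = 0 ∨
      (i + 1).val = i.val + 1 ∧ (i + 1).val ≤ m := by
    intro i
    have h1 : i + 1 = ((i.val + 1 : ℕ) : ZMod (m + 1)) := by
      push_cast; rw [ZMod.natCast_zmod_val]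
    rcases (hval i).eq_or_lt with h | h
    · refine Or.inl ⟨h, ?_⟩
      rw [h1, h, ZMod.natCast_self, ZMod.val_zero]
    · have : (i + 1).val = i.val + 1 := by rw [h1, ZMod.val_cast_of_lt (by omega)]
      exact Or.inr ⟨this, by omega⟩
  have hsub : ∀ i : ZMod (m + 1), i.val = 0 ∧ (i - 1).val = m ∨ i.val = (i - 1).val + 1 := by
    intro i
    have := hadd (i - 1)
    rw [sub_add_cancel] at this
    omega
  have hlen : pathLength g m = pathLength (fun i : ℕ => f i) m :=
    Finset.sum_congr rfl fun i hi => hsucc i (Finset.mem_range.1 hi)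
  have hbelow : ∀ i j : ℕ, i ≤ j → j ≤ m → BelowDiam κ (dist (g i) (g j)) := by
    intro i j hij hj
    refine hperim.mono ?_
    rw [← hlen, ← hclose]
    linarith [dist_add_dist_le_pathLength g hij hj, dist_triangle4 (g i) (g 0) (g m) (g j),
      dist_comm (g i) (g 0), dist_comm (g 0) (g m), dist_comm (g m) (g j)]
  have hbelow' : ∀ i j : ℕ, i ≤ m → j ≤ m → BelowDiam κ (dist (g i) (g j)) := by
    intro i j hi hj
    rcases le_total i j with h | h
    · exact hbelow i j h hj
    · rw [dist_comm]; exact hbelow j i h hi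
  refine ⟨fun i => g i.val, fun i j => ⟨?_, ?_⟩, fun i j hij => ?_⟩
  · have hi : i + 1 = ((i.val + 1 : ℕ) : ZMod (m + 1)) := by
      push_cast; rw [ZMod.natCast_zmod_val]
    rcases hadd i with ⟨h1, h2⟩ | ⟨h1, h2⟩
    · have e1 : (m : ZMod (m + 1)) = i :=
        (congrArg Nat.cast h1).symm.trans (ZMod.natCast_zmod_val i)
      have e2 : ((0 : ℕ) : ZMod (m + 1)) = i + 1 :=
        (congrArg Nat.cast h2).symm.trans (ZMod.natCast_zmod_val (i + 1))
      simp only [h1, h2, hclose, e1, e2]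
    · simp only [h1]
      rw [hsucc _ (by omega), hi, ZMod.natCast_zmod_val]
  · simpa only [ZMod.natCast_zmod_val] using hle _ (hval i) _ (hval j)
  · have hmeet := hconv.meet_neighbours (hval i) (hval j)
      (fun h => hij (ZMod.val_injective _ h)) (hsub i) (hadd i)
    have h1 := hbelow' _ _ (hval i) (hval j)
    have h2 := hbelow' _ _ (hval (i - 1)) (hval (i + 1))
    obtain ⟨p, hp1, hp2⟩ := hmeet.exists_btw h1 h2
    exact ⟨p, hp1.mem_geodesicSegment h1, hp2.mem_geodesicSegment h2⟩

end ModelPlane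

theorem mainTheorem1 (κ : ℝ) (X : Type*) [MetricSpace X] (hX : IsCycl 4 κ X)
    (n : ℕ) [NeZero n] (hn : 3 ≤ n) (f : ZMod n → X)
    (hperim : (cyclicPerimeter f : EReal) < 2 * modelDiam κ)
    (hf : ∀ j : ZMod n, f j ≠ f (j + 1)) :
    ∃ g : ZMod n → ModelPlane κ,
      (∀ i j : ZMod n, dist (g i) (g (i + 1)) = dist (f i) (f (i + 1)) ∧
        dist (f i) (f j) ≤ dist (g i) (g j)) ∧
      (∀ i j : ZMod n, i ≠ j →
        (geodesicSegment (g i) (g j) ∩ geodesicSegment (g (i - 1)) (g (i + 1))).Nonempty) := by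
  obtain ⟨m, rfl⟩ : ∃ m, n = m + 1 := ⟨n - 1, by omega⟩
  exact hX.exists_convex_polygon (by omega) f hperim
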